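/- Let $K\subset\mathbb{C}$ be an imaginary quadratic field with ring of integers $\mathcal{O}_K$ and discriminant $\Delta<0$. A $K$-Bianchi circle is an image $M(\widehat{\mathbb{R}})\subset\widehat{\mathbb{C}}$ of $\widehat{\mathbb{R}}=\mathbb{R}\cup\{\infty\}$ under a Möbius transformation $M\in\mathrm{PSL}_2(\mathcal{O}_K)$. Let $\mathcal{S}_K$ be the set of $K$-Bianchi circles that are not straight lines (i.e. do not pass through $\infty$; equivalently, have non-zero curvature), considered without orientation. Write $C\sim C'$ if $C'=uC+t$ for some unit $u\in\mathcal{O}_K^{*}$ and some $t\in\mathcal{O}_K$. The curvature of a circle is the inverse of its radius. For an integer $f\ge 1$ let $\mathcal{O}_f=\mathbb{Z}+f\mathcal{O}_K$ be the order of conductor $f$, let $\mathrm{Pic}(\mathcal{O}_f)$ be the group of invertible fractional ideals of $\mathcal{O}_f$ modulo principal ones, and let $\theta_f:\mathrm{Pic}(\mathcal{O}_f)\to\mathrm{Pic}(\mathcal{O}_K)$, $[\mathfrak{a}]\mapsto[\mathfrak{a}\mathcal{O}_K]$, be the ideal-extension homomorphism. Then there is a bijection $$\mathcal{S}_K/\!\sim\;\;\longleftrightarrow\;\;\bigsqcup_{f\ge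 1}\ker\theta_f$$ such that every circle whose class corresponds to an element of $\ker\theta_f$ has curvature $\sqrt{-\Delta}\,f$, and such that, for every $M=\begin{pmatrix}\alpha&\gamma\\ \beta&\delta\end{pmatrix}\in\mathrm{PSL}_2(\mathcal{O}_K)$ for which $M(\widehat{\mathbb{R}})$ is not a straight line, the class of $M(\widehat{\mathbb{R}})$ corresponds to the class of the lattice $\Lambda=\mathbb{Z}\beta+\mathbb{Z}\delta$; that is, $\Lambda$ has order $\{x\in\mathcal{O}_K: x\Lambda\subseteq\Lambda\}=\mathcal{O}_f$ for the corresponding $f$, and $\Lambda$ is an invertible fractional ideal of $\mathcal{O}_f$ representing the corresponding class in $\ker\theta_f\subseteq\mathrm{Pic}(\mathcal{O}_f)$. -/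

import Mathlib

open NumberField
open scoped nonZeroDivisors OnePoint Pointwise

noncomputable section

namespace SchmidtArrangement

/-! ### The arrangement: circles in the Riemann sphere `OnePoint ℂ` -/

/-- The extended real line `ℝ ∪ {∞}` inside the Riemann sphere `ℂ ∪ {∞}`. -/
def extendedReals : Set (OnePoint ℂ) :=
  Set.range (OnePoint.map ((↑) : ℝ → ℂ))

section Circles

variable {K : Type*} [Field K] (σ : K →+* ℂ)

/-- A matrix of `SL₂(𝓞 K)` regarded, through the embedding `σ`, as an element of `GL₂(ℂ)`. -/
def toGL (M : Matrix.SpecialLinearGroup (Fin 2) (𝓞 K)) : GL (Fin 2) ℂ :=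
  Matrix.SpecialLinearGroup.toGL
    (Matrix.SpecialLinearGroup.map (σ.comp (algebraMap (𝓞 K) K)) M)

/-- The image of the extended real line under the Möbius transformation given by
`M ∈ SL₂(𝓞 K)`, namely `z ↦ (M₀₀ z + M₀₁) / (M₁₀ z + M₁₁)`. -/
def circleOf (M : Matrix.SpecialLinearGroup (Fin 2) (𝓞 K)) : Set (OnePoint ℂ) :=
  (fun z : OnePoint ℂ => toGL σ M • z) '' extendedReals

/-- The Schmidt arrangement: the set of all `K`-Bianchi circles, that is, the orbit of the
extended real line under `PSL₂(𝓞 K)` (equivalently, under `SL₂(𝓞 K)`). -/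
def schmidtArrangement : Set (Set (OnePoint ℂ)) :=
  Set.range (circleOf σ)

/-- The affine map `z ↦ u z + t` (`u` a unit and `t` an element of `𝓞 K`) of the Riemann sphere,
fixing `∞`. -/
def affineMap (u : (𝓞 K)ˣ) (t : 𝓞 K) : OnePoint ℂ → OnePoint ℂ :=
  OnePoint.map fun z : ℂ => σ (((u : 𝓞 K) : K)) * z + σ (t : K)

/-- Two sets are equivalent when one is carried to the other by a combination of multiplication
by a unit of `𝓞 K` and translation by an element of `𝓞 K`. -/
def CircleEquiv (C D : Set (OnePoint ℂ)) : Prop :=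
  ∃ (u : (𝓞 K)ˣ) (t : 𝓞 K), affineMap σ u t '' C = D

theorem affineMap_one_zero : affineMap σ 1 0 = id := by
  have : (fun z : ℂ => σ (((1 : (𝓞 K)ˣ) : 𝓞 K) : K) * z + σ ((0 : 𝓞 K) : K)) = id := by
    funext z; simp
  rw [affineMap, this, OnePoint.map_id]

theorem affineMap_comp (u v : (𝓞 K)ˣ) (s t : 𝓞 K) :
    affineMap σ v t ∘ affineMap σ u s = affineMap σ (v * u) (v * s + t) := by
  rw [affineMap, affineMap, affineMap, ← OnePoint.map_comp]
  congr 1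
  funext z
  simp only [Function.comp_apply, Units.val_mul, map_mul, map_add]
  ring

theorem circleEquiv_equivalence : Equivalence (CircleEquiv σ) where
  refl C := ⟨1, 0, by rw [affineMap_one_zero, Set.image_id]⟩
  symm := by
    rintro C _ ⟨u, t, rfl⟩
    refine ⟨u⁻¹, -(((u⁻¹ : (𝓞 K)ˣ) : 𝓞 K) * t), ?_⟩
    rw [← Set.image_comp, affineMap_comp]
    simp [affineMap_one_zero]
  trans := by
    rintro C _ _ ⟨u, s, rfl⟩ ⟨v, t, rfl⟩
    exact ⟨v * u, v * s + t, by rw [← affineMap_comp, Set.image_comp]⟩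

/-- The `K`-Bianchi circles that are not straight lines, i.e. do not pass through `∞`. -/
def BianchiCircle : Type :=
  {C : Set (OnePoint ℂ) // C ∈ schmidtArrangement σ ∧ ∞ ∉ C}

/-- Equivalence of `K`-Bianchi circles. -/
instance bianchiSetoid : Setoid (BianchiCircle σ) where
  r C D := CircleEquiv σ C.1 D.1
  iseqv :=
    ⟨fun C => (circleEquiv_equivalence σ).refl C.1,
     fun h => (circleEquiv_equivalence σ).symm h,
     fun h h' => (circleEquiv_equivalence σ).trans h h'⟩

end Circles

/-- The (non-oriented) circle `C` has curvature `κ`: it is the locus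
`b X X̄ - a Y X̄ - ā X Ȳ + b' Y Ȳ = 0` (`z = X / Y`, with `∞ = 1 / 0`) for some
`b, b' ∈ ℝ`, `a ∈ ℂ` with `b' b = a ā - 1` and `|b| = κ`.
For `κ > 0` this is the circle of centre `a / b` and radius `1 / κ`. -/
def HasCurvature (C : Set (OnePoint ℂ)) (κ : ℝ) : Prop :=
  ∃ (b b' : ℝ) (a : ℂ), b' * b = Complex.normSq a - 1 ∧ |b| = κ ∧
    (∞ ∈ C ↔ b = 0) ∧
    ∀ z : ℂ, (z : OnePoint ℂ) ∈ C ↔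
      (b : ℂ) * (z * star z) - a * star z - star a * z + (b' : ℂ) = 0

/-! ### Orders, their class groups, and lattices -/

section Orders

variable (K : Type*) [Field K]

/-- The order `ℤ + f 𝓞 K` of conductor `f` of the quadratic field `K`. -/
def conductorOrder (f : ℕ+) : Subalgebra ℤ (𝓞 K) where
  carrier := {x | ∃ (n : ℤ) (y : 𝓞 K), x = n + (f : ℕ) * y}
  mul_mem' := by
    rintro _ _ ⟨n, y, rfl⟩ ⟨m, z, rfl⟩
    exact ⟨n * m, n * z + m * y + (f : ℕ) * (y * z), by push_cast; ring⟩
  add_mem' := by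
    rintro _ _ ⟨n, y, rfl⟩ ⟨m, z, rfl⟩
    exact ⟨n + m, y + z, by push_cast; ring⟩
  algebraMap_mem' n := ⟨n, 0, by simp⟩

variable [NumberField K]

instance conductorOrder_isFractionRing (f : ℕ+) : IsFractionRing (conductorOrder K f) K := by
  have hinj : Function.Injective (algebraMap (conductorOrder K f) K) := by
    intro x y h
    exact Subtype.ext (RingOfIntegers.ext h)
  have hf : ((f : ℕ) : 𝓞 K) ≠ 0 := by exact_mod_cast f.ne_zero
  have hmem : ∀ y : 𝓞 K, ((f : ℕ) : 𝓞 K) * y ∈ conductorOrder K f := fun y => ⟨0, y, by simp⟩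
  have : FaithfulSMul (conductorOrder K f) K := (faithfulSMul_iff_algebraMap_injective _ _).2 hinj
  refine IsFractionRing.of_field _ _ fun z => ?_
  obtain ⟨x, y, hy, rfl⟩ := IsFractionRing.div_surjective (A := 𝓞 K) z
  have hy0 : y ≠ 0 := nonZeroDivisors.ne_zero hy
  refine ⟨⟨_, hmem x⟩, ⟨_, hmem y⟩, ?_⟩
  change algebraMap (𝓞 K) K x / algebraMap (𝓞 K) K y =
    algebraMap (𝓞 K) K ((f : ℕ) * x) / algebraMap (𝓞 K) K ((f : ℕ) * y)
  have hf' : algebraMap (𝓞 K) K ((f : ℕ) : 𝓞 K) ≠ 0 := by simp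
  rw [map_mul, map_mul, mul_div_mul_left _ _ hf']

/-- The ideal-extension homomorphism `θ_f : Pic(O_f) → Pic(𝓞 K)`, `[𝔞] ↦ [𝔞 𝓞 K]`. -/
def theta (f : ℕ+) : ClassGroup (conductorOrder K f) →* ClassGroup (𝓞 K) :=
  ClassGroup.extendedHom (conductorOrder K f) (𝓞 K)

variable {K}

/-- The lattice `ℤ β + ℤ δ` in `𝓞 K`. -/
def lattice (β δ : 𝓞 K) : Submodule ℤ (𝓞 K) :=
  Submodule.span ℤ {β, δ}

/-- The order `Ord(Λ) = {α ∈ 𝓞 K : α Λ ⊆ Λ}` of a lattice `Λ` in `𝓞 K`. -/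
def latticeOrder (Λ : Submodule ℤ (𝓞 K)) : Subalgebra ℤ (𝓞 K) where
  carrier := {α | ∀ x ∈ Λ, α * x ∈ Λ}
  mul_mem' := by
    intro a b ha hb x hx
    rw [mul_assoc]
    exact ha _ (hb _ hx)
  add_mem' := by
    intro a b ha hb x hx
    rw [add_mul]
    exact Λ.add_mem (ha _ hx) (hb _ hx)
  algebraMap_mem' n x hx := by
    rw [← Algebra.smul_def]
    exact Λ.smul_mem n hx

/-- The lattice `Λ` has order `O_f` and, as an invertible fractional ideal of `O_f`,
it represents the class `c ∈ Pic(O_f)`. -/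
def RepresentsClass (Λ : Submodule ℤ (𝓞 K)) (f : ℕ+) (c : ClassGroup (conductorOrder K f)) : Prop :=
  latticeOrder Λ = conductorOrder K f ∧
    ∃ I : (FractionalIdeal (conductorOrder K f)⁰ K)ˣ,
      (∀ x : K, x ∈ (I : FractionalIdeal (conductorOrder K f)⁰ K) ↔ ∃ y ∈ Λ, (y : K) = x) ∧
      ClassGroup.mk K I = c

end Orders

end SchmidtArrangement

end

open SchmidtArrangement

/-! ### Integral basis, complex conjugation and discriminant -/

namespace SchmidtArrangement

noncomputable section

open Module

/-! A circle `M(ℝ̂)` is studied through the bottom row `(β, δ)` of `M` and the lattice `Λ = ℤβ +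
ℤδ`. A matrix of `GL₂(𝓞 K)` preserving `ℝ̂` is a unit times a matrix of `GL₂(ℤ)`
(`exists_unit_mul_integral`). Hence two circles are equivalent exactly when `M' = A M N` with `A`
upper triangular over `𝓞 K` and `N` such a matrix: `A` multiplies the bottom row by a unit and `N`
changes the basis of `Λ` up to a unit. So classes of circles are unimodular lattices up to units
(`exists_unit_of_circleEquiv`, `circleEquiv_of_lattice`).

The integer `κ = (βδ̄ - β̄δ)/(ω - ω̄)` is, up to sign, the index of `Λ` in `𝓞 K` when nonzero. The
Hermitian equation of the circle has leading coefficient `±2 Im(βδ̄) = ±2κ Im ω`, and `2 Im ω =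
√(-Δ)`, so the curvature is `√(-Δ) f` with `f = |κ|`.

Taking the norm of `aβ + cδ = 1` shows that `N(β)`, `N(δ)` and the rational part of `βδ̄` are
jointly coprime to `κ` (`exists_bezout`). This one identity gives both that the multiplier ring of
`Λ` is exactly `O_f` (`latticeOrder_lattice`) and that `Λ Λ̄ = O_f`, so `Λ` is invertible
(`latticeIdeal_mul_conj`). Its extension is `𝓞 K` because `β, δ` generate the unit ideal, so its
class lies in `ker θ_f`.

Conversely, an ideal with principal extension can be scaled so that the extension is `𝓞 K`; it is
then a lattice with unimodular generators, which form the bottom row of a matrix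
(`exists_matrix_of_mem_ker`). If two such lattices have the same class, the scaling factor must be a
unit of `𝓞 K` (`exists_unit_of_representsClass`), which gives injectivity. -/

/-- The restriction to the ring of integers of a complex embedding of `K`. -/
def intEmb {K : Type*} [Field K] (σ : K →+* ℂ) : 𝓞 K →+* ℂ :=
  σ.comp (algebraMap (𝓞 K) K)

theorem intEmb_injective {K : Type*} [Field K] (σ : K →+* ℂ) : Function.Injective (intEmb σ) :=
  fun _ _ h => RingOfIntegers.ext (σ.injective h)

/-- An imaginary quadratic ring of integers in coordinates: `𝓞 K = ℤ + ℤ ω` with `σ ω` in the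
upper half-plane, together with the restriction of complex conjugation to `𝓞 K`. -/
structure QuadraticFrame {K : Type*} [Field K] (σ : K →+* ℂ) where
  /-- complex conjugation on the ring of integers -/
  conj : 𝓞 K →+* 𝓞 K
  /-- the second element of an integral basis starting with `1` -/
  ω : 𝓞 K
  intEmb_conj : ∀ x, intEmb σ (conj x) = star (intEmb σ x)
  exists_coord : ∀ x : 𝓞 K, ∃ m k : ℤ, x = m + k * ω
  im_pos : 0 < (intEmb σ ω).im

/-- The coordinates of `1` are coprime, because a common divisor would divide `1` in `R` and `ℤ → R`
reflects units; a coprime pair completes to a unimodular matrix. -/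
theorem exists_basis_one {R : Type*} [CommRing R] [Nontrivial R] [IsLocalHom (algebraMap ℤ R)]
    (e : Basis (Fin 2) ℤ R) : ∃ b : Basis (Fin 2) ℤ R, b 0 = 1 := by
  set p := e.repr 1 0
  set q := e.repr 1 1
  have h1 : (1 : R) = p • e 0 + q • e 1 := by
    rw [← e.sum_repr 1, Fin.sum_univ_two]
  obtain ⟨d, hd⟩ : ∃ d, d = gcd p q := ⟨_, rfl⟩
  obtain ⟨p', hp⟩ : d ∣ p := hd ▸ gcd_dvd_left p q
  obtain ⟨q', hq⟩ : d ∣ q := hd ▸ gcd_dvd_right p q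
  have hu : IsUnit (algebraMap ℤ R d) := by
    refine IsUnit.of_mul_eq_one (p' • e 0 + q' • e 1) ?_
    rw [← Algebra.smul_def, smul_add, smul_smul, smul_smul, ← hp, ← hq, ← h1]
  have hpq : IsCoprime p q := by
    rw [← gcd_isUnit_iff, ← hd]
    exact isUnit_of_map_unit _ _ hu
  obtain ⟨u, v, huv⟩ := hpq
  -- Second row completing `(p, q)` to determinant `u p + v q = 1`.
  let f : R := -v • e 0 + u • e 1
  refine ⟨Basis.mk (v := ![1, f]) ?_ ?_, by rw [Basis.mk_apply]; rfl⟩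
  · rw [LinearIndependent.pair_iff]
    intro s t hst
    have hli := LinearIndependent.pair_iff.1
      (show LinearIndependent ℤ ![e 0, e 1] by
        convert e.linearIndependent using 1
        ext i; fin_cases i <;> rfl)
    obtain ⟨h0, h2⟩ := hli (s * p - t * v) (s * q + t * u) (by
      rw [← hst, h1]; simp only [f]; module)
    have hs : s = 0 := by linear_combination u * h0 + v * h2 - s * huv
    subst hs
    refine ⟨rfl, ?_⟩
    linear_combination p * h2 - q * h0 - t * huv
  · rintro x -
    rw [Matrix.range_cons, Matrix.range_cons, Matrix.range_empty, Set.union_empty,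
      Set.singleton_union, Submodule.mem_span_pair]
    refine ⟨e.repr x 0 * u + e.repr x 1 * v, e.repr x 1 * p - e.repr x 0 * q, ?_⟩
    conv_rhs => rw [← e.sum_repr x, Fin.sum_univ_two]
    rw [h1]
    simp only [f]
    have : ∀ a b c d : ℤ, a = c → b = d → a • e 0 + b • e 1 = c • e 0 + d • e 1 := by
      rintro a b c d rfl rfl; rfl
    rw [smul_add, smul_add, smul_smul, smul_smul, smul_smul, smul_smul, add_add_add_comm,
      ← add_smul, ← add_smul]
    apply this
    · linear_combination (e.repr x 0) * huv
    · linear_combination (e.repr x 1) * huv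

/-- The discriminant of a basis `1, w` of a ring in which `w` is a root of `X² - t X + n`. -/
theorem discr_of_basis_one {R : Type*} [CommRing R] (b : Basis (Fin 2) ℤ R) (h0 : b 0 = 1)
    (t n : ℤ) (h : b 1 * b 1 = t * b 1 - n) : Algebra.discr ℤ b = t ^ 2 - 4 * n := by
  have tr1 : Algebra.trace ℤ R 1 = 2 := by
    rw [← map_one (algebraMap ℤ R), Algebra.trace_algebraMap_of_basis b]; simp
  have trw : Algebra.trace ℤ R (b 1) = t := by
    have e0 : b 1 * b 0 = b 1 := by rw [h0, mul_one]
    have e1 : b 1 * b 1 = t • b 1 - n • b 0 := by rw [h, h0]; simp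
    rw [Algebra.trace_eq_matrix_trace b, Matrix.trace_fin_two, Algebra.leftMulMatrix_eq_repr_mul,
      Algebra.leftMulMatrix_eq_repr_mul, e0, e1]
    simp [-zsmul_eq_mul]
  have trww : Algebra.trace ℤ R (b 1 * b 1) = t * t - 2 * n := by
    have e1 : b 1 * b 1 = t • b 1 - n • 1 := by rw [h]; simp
    rw [e1, map_sub, map_smul, map_smul, trw, tr1]
    simp; ring
  rw [Algebra.discr_def, Matrix.det_fin_two]
  simp only [Algebra.traceMatrix_apply, Algebra.traceForm_apply, h0, mul_one, one_mul, tr1, trw,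
    trww]
  ring

/-- For `z² = p + q z` with `z` not real, the imaginary part gives `2 Re z = q`, and then the real
part gives `q² + 4p = -(2 Im z)²`; the left side is the discriminant. The sign of `z` is chosen to
make `Im z` positive. -/
theorem exists_quadraticFrame {K : Type*} [Field K] [NumberField K]
    [Algebra.IsQuadraticExtension ℚ K] [IsTotallyComplex K] (σ : K →+* ℂ) :
    ∃ F : QuadraticFrame σ, 2 * (intEmb σ F.ω).im = √(-(discr K : ℝ)) := by
  have : IsCMField K := IsCMField.ofCMExtension ℚ K
  let c : 𝓞 K →+* 𝓞 K := (IsCMField.ringOfIntegersComplexConj K : 𝓞 K →+* 𝓞 K)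
  have hc : ∀ x, intEmb σ (c x) = star (intEmb σ x) := by
    intro x
    change σ ((IsCMField.ringOfIntegersComplexConj K x : 𝓞 K) : K) = _
    rw [IsCMField.coe_ringOfIntegersComplexConj, IsCMField.complexEmbedding_complexConj]
    rfl
  have hcard : Fintype.card (Free.ChooseBasisIndex ℤ (𝓞 K)) = Fintype.card (Fin 2) := by
    rw [← finrank_eq_card_chooseBasisIndex, RingOfIntegers.rank,
      Algebra.IsQuadraticExtension.finrank_eq_two, Fintype.card_fin]
  obtain ⟨b, hb⟩ := exists_basis_one
    ((RingOfIntegers.basis K).reindex (Fintype.equivOfCardEq hcard))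
  have hco : ∀ x : 𝓞 K, ∃ m k : ℤ, x = m + k * b 1 := by
    intro x
    refine ⟨b.repr x 0, b.repr x 1, ?_⟩
    conv_lhs => rw [← b.sum_repr x, Fin.sum_univ_two, hb]
    simp
  obtain ⟨p, q, hpq⟩ := hco (b 1 * b 1)
  set z := intEmb σ (b 1) with hz
  have hzz : z * z = p + q * z := by
    rw [hz, ← map_mul, hpq]; simp
  have hdisc : (discr K : ℤ) = q ^ 2 - 4 * (-p) := by
    rw [← discr_eq_discr K b]
    exact discr_of_basis_one b hb q (-p) (by rw [hpq]; push_cast; ring)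
  -- Were `z` real, conjugation would fix `ℤ + ℤz = 𝓞 K`, hence `K`, which a CM field forbids.
  have him0 : z.im ≠ 0 := by
    intro h0
    have hcw : c (b 1) = b 1 := intEmb_injective σ (by
      rw [hc, ← hz]; exact Complex.conj_eq_iff_im.2 h0)
    have hcx : ∀ x, c x = x := by
      intro x
      obtain ⟨m, k, rfl⟩ := hco x
      simp [hcw]
    refine IsCMField.complexConj_ne_one K (AlgEquiv.ext fun x => ?_)
    obtain ⟨x, y, -, rfl⟩ := IsFractionRing.div_surjective (A := 𝓞 K) x
    rw [map_div₀, ← IsCMField.coe_ringOfIntegersComplexConj,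
      ← IsCMField.coe_ringOfIntegersComplexConj]
    change ((c x : 𝓞 K) : K) / ((c y : 𝓞 K) : K) = _
    rw [hcx, hcx]
    rfl
  have hre : 2 * z.re = q := by
    have := congrArg Complex.im hzz
    simp only [Complex.mul_im, Complex.add_im, Complex.intCast_im, Complex.intCast_re] at this
    apply mul_right_cancel₀ him0
    linear_combination this
  have hre2 : z.re ^ 2 - z.im ^ 2 = p + q * z.re := by
    have := congrArg Complex.re hzz
    simp only [Complex.mul_re, Complex.add_re, Complex.intCast_im, Complex.intCast_re] at this
    linear_combination this
  have hD : -(discr K : ℝ) = (2 * z.im) ^ 2 := by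
    rw [hdisc]
    push_cast
    rw [← hre] at hre2 ⊢
    linear_combination 4 * hre2
  rcases him0.lt_or_gt with h | h
  · refine ⟨⟨c, -b 1, hc, fun x => ?_, ?_⟩, ?_⟩
    · obtain ⟨m, k, rfl⟩ := hco x
      exact ⟨m, -k, by push_cast; ring⟩
    · rw [map_neg, Complex.neg_im]
      exact neg_pos.2 h
    · rw [hD, Real.sqrt_sq_eq_abs, abs_of_neg (by linarith), map_neg, Complex.neg_im]
      ring
  · refine ⟨⟨c, b 1, hc, hco, h⟩, ?_⟩
    rw [hD, Real.sqrt_sq_eq_abs, abs_of_pos (by linarith)]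

end

end SchmidtArrangement

/-! ### Lattices, the alternating form and multiplier rings -/

namespace SchmidtArrangement

noncomputable section

theorem mem_lattice {K : Type*} [Field K] {β δ x : 𝓞 K} :
    x ∈ lattice β δ ↔ ∃ p q : ℤ, (p : 𝓞 K) * β + q * δ = x := by
  simp [lattice, Submodule.mem_span_pair]

theorem left_mem_lattice {K : Type*} [Field K] (β δ : 𝓞 K) : β ∈ lattice β δ :=
  Submodule.subset_span (by simp)

theorem right_mem_lattice {K : Type*} [Field K] (β δ : 𝓞 K) : δ ∈ lattice β δ :=
  Submodule.subset_span (by simp)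

namespace QuadraticFrame

variable {K : Type*} [Field K] {σ : K →+* ℂ} (F : QuadraticFrame σ)

theorem conj_conj (x : 𝓞 K) : F.conj (F.conj x) = x :=
  intEmb_injective σ (by rw [F.intEmb_conj, F.intEmb_conj, star_star])

theorem sub_conj_ω_ne_zero : F.ω - F.conj F.ω ≠ 0 := by
  intro h
  have h1 := congrArg Complex.im (congrArg (intEmb σ) h)
  rw [map_sub, F.intEmb_conj, map_zero, Complex.sub_im] at h1
  have h2 : (star (intEmb σ F.ω)).im = -(intEmb σ F.ω).im := rfl
  rw [h2] at h1
  have := F.im_pos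
  simp at h1
  linarith

/-- The coefficient of `ω` in an element of `𝓞 K = ℤ + ℤ ω`. -/
def coord (x : 𝓞 K) : ℤ := (F.exists_coord x).choose_spec.choose

theorem exists_eq_add_coord (x : 𝓞 K) : ∃ m : ℤ, x = m + F.coord x * F.ω :=
  ⟨_, (F.exists_coord x).choose_spec.choose_spec⟩

/-- Since `ω - ω̄ ≠ 0`, this turns identities between integer coordinates into ring identities in
elements and their conjugates. -/
theorem sub_conj (x : 𝓞 K) : x - F.conj x = F.coord x * (F.ω - F.conj F.ω) := by
  obtain ⟨m, hm⟩ := F.exists_eq_add_coord x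
  conv_lhs => rw [hm]
  simp only [map_add, map_mul, map_intCast]
  ring

theorem intEmb_im (x : 𝓞 K) : (intEmb σ x).im = F.coord x * (intEmb σ F.ω).im := by
  obtain ⟨m, hm⟩ := F.exists_eq_add_coord x
  conv_lhs => rw [hm]
  simp

theorem conj_eq_zero {x : 𝓞 K} : F.conj x = 0 ↔ x = 0 :=
  ⟨fun h => by rw [← F.conj_conj x, h, map_zero], fun h => by rw [h, map_zero]⟩

/-- The alternating form `(x, y) ↦ (x ȳ - x̄ y) / (ω - ω̄)` on `𝓞 K`. -/
def cross (x y : 𝓞 K) : ℤ := F.coord (x * F.conj y)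

theorem cross_mul (x y : 𝓞 K) :
    F.cross x y * (F.ω - F.conj F.ω) = x * F.conj y - F.conj x * y := by
  rw [cross, ← F.sub_conj, map_mul, F.conj_conj]

/-- Cramer's rule for the alternating form: `x` is expressed through `β, δ` with denominator `cross
β δ`. -/
theorem cross_mul_eq (β δ x : 𝓞 K) :
    F.cross β δ * x = F.cross x δ * β - F.cross x β * δ := by
  apply mul_right_cancel₀ F.sub_conj_ω_ne_zero
  linear_combination x * F.cross_mul β δ - β * F.cross_mul x δ + δ * F.cross_mul x β

theorem cross_mul_mem_lattice (β δ x : 𝓞 K) : F.cross β δ * x ∈ lattice β δ :=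
  mem_lattice.2 ⟨F.cross x δ, -F.cross x β, by rw [F.cross_mul_eq β δ x]; push_cast; ring⟩

/-- An order of conductor `f` preserves a lattice of index `f`. -/
theorem mul_mem_lattice {β δ : 𝓞 K} {f : ℕ+} (hf : |F.cross β δ| = (f : ℕ)) {x y : 𝓞 K}
    (hx : x ∈ conductorOrder K f) (hy : y ∈ lattice β δ) : x * y ∈ lattice β δ := by
  obtain ⟨n, z, rfl⟩ := hx
  have hfm : ((f : ℕ) : 𝓞 K) * (z * y) ∈ lattice β δ := by
    have h := F.cross_mul_mem_lattice β δ (z * y)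
    rcases (abs_eq (by positivity)).1 hf with h1 | h1
    · rw [h1] at h
      simpa using h
    · rw [h1] at h
      simpa using (lattice β δ).neg_mem h
  have := (lattice β δ).add_mem ((lattice β δ).smul_mem n hy) hfm
  rw [zsmul_eq_mul] at this
  convert this using 1
  ring

end QuadraticFrame

variable {K : Type*} [Field K] [NumberField K]

namespace QuadraticFrame

variable {σ : K →+* ℂ} (F : QuadraticFrame σ)

theorem coord_eq {x : 𝓞 K} {k : ℤ} (h : x - F.conj x = k * (F.ω - F.conj F.ω)) :
    F.coord x = k := by
  rw [F.sub_conj] at h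
  exact_mod_cast mul_right_cancel₀ F.sub_conj_ω_ne_zero h

theorem coord_add_mul (m k : ℤ) : F.coord (m + k * F.ω) = k :=
  F.coord_eq (by simp only [map_add, map_mul, map_intCast]; ring)

theorem exists_intCast_of_conj_eq {x : 𝓞 K} (h : F.conj x = x) : ∃ n : ℤ, x = n := by
  obtain ⟨m, hm⟩ := F.exists_eq_add_coord x
  have : F.coord x = 0 := F.coord_eq (by rw [h]; simp)
  exact ⟨m, by rw [hm, this]; simp⟩

theorem exists_norm (x : 𝓞 K) : ∃ n : ℤ, x * F.conj x = n :=
  F.exists_intCast_of_conj_eq (by rw [map_mul, F.conj_conj, mul_comm])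

theorem exists_trace (x : 𝓞 K) : ∃ n : ℤ, x + F.conj x = n :=
  F.exists_intCast_of_conj_eq (by rw [map_add, F.conj_conj, add_comm])

theorem cross_eq {x y : 𝓞 K} {k : ℤ}
    (h : x * F.conj y - F.conj x * y = k * (F.ω - F.conj F.ω)) : F.cross x y = k :=
  F.coord_eq (by rw [map_mul, F.conj_conj, h])

theorem cross_conj (x y : 𝓞 K) : F.cross (F.conj x) (F.conj y) = -F.cross x y := by
  apply F.cross_eq
  rw [F.conj_conj, F.conj_conj]
  push_cast
  linear_combination F.cross_mul x y

/-- If `β, δ` generate the unit ideal, then the coefficients of the form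
`N (β x + δ y)` are coprime modulo `cross β δ`. -/
theorem exists_bezout {a c β δ : 𝓞 K} (h : a * β + c * δ = 1) {m nβ nδ : ℤ}
    (hm : β * F.conj δ = m + F.cross β δ * F.ω) (hβ : β * F.conj β = nβ)
    (hδ : δ * F.conj δ = nδ) :
    ∃ i j k l : ℤ, i * nβ + j * m + k * nδ + l * F.cross β δ = 1 := by
  obtain ⟨na, ha⟩ := F.exists_norm a
  obtain ⟨nc, hc⟩ := F.exists_norm c
  obtain ⟨u, hu⟩ := F.exists_eq_add_coord (a * F.conj c)
  set v := F.coord (a * F.conj c)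
  obtain ⟨t, ht⟩ := F.exists_trace F.ω
  obtain ⟨s, hs⟩ := F.exists_trace (F.ω * F.ω)
  have hm' := congrArg F.conj hm
  have hu' := congrArg F.conj hu
  have h' := congrArg F.conj h
  simp only [map_add, map_mul, map_intCast, F.conj_conj, map_one] at hm' hu' h' hs
  -- Coefficients of `N(a)N(β) + N(c)N(δ) + Tr(ac̄ · βδ̄) = 1`, with `ac̄ = u + vω`, `βδ̄ = m + κω`,
  -- `t = Tr ω`, `s = Tr ω²`.
  refine ⟨na, 2 * u + v * t, nc, u * t + v * s, ?_⟩
  have : ((na * nβ + (2 * u + v * t) * m + nc * nδ + (u * t + v * s) * F.cross β δ : ℤ) : 𝓞 K)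
      = (1 : ℤ) := by
    push_cast
    rw [← ha, ← hβ, ← hc, ← hδ, ← ht, ← hs]
    have e : (1 : 𝓞 K) = (a * β + c * δ) * (F.conj a * F.conj β + F.conj c * F.conj δ) := by
      rw [h, h', one_mul]
    have e2 : (1 : 𝓞 K) = a * F.conj a * (β * F.conj β) + c * F.conj c * (δ * F.conj δ)
        + (a * F.conj c) * (β * F.conj δ) + (F.conj a * c) * (F.conj β * δ) := by
      rw [e]; ring
    rw [hu, hu', hm, hm'] at e2
    linear_combination -e2
  exact_mod_cast this

/-- If `r + sω` is a multiplier, then so is `sω`, and this forces `κ` to divide `s N(β)`, `s N(δ)`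
and `s(m + κt)`; by the Bézout identity `κ ∣ s`. The other inclusion follows from `κ 𝓞 K ⊆ Λ`. -/
theorem latticeOrder_lattice {a c β δ : 𝓞 K} (h : a * β + c * δ = 1) {f : ℕ+}
    (hf : |F.cross β δ| = (f : ℕ)) : latticeOrder (lattice β δ) = conductorOrder K f := by
  apply le_antisymm
  · intro x hx
    obtain ⟨r, hr⟩ := F.exists_eq_add_coord x
    set s := F.coord x
    have hmul : ∀ y ∈ lattice β δ, (s : 𝓞 K) * F.ω * y ∈ lattice β δ := by
      intro y hy
      have := (lattice β δ).sub_mem (hx y hy) ((lattice β δ).smul_mem r hy)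
      rw [zsmul_eq_mul, ← sub_mul] at this
      rw [hr] at this
      convert this using 1
      ring
    obtain ⟨p, q, hpq⟩ := mem_lattice.1 (hmul β (left_mem_lattice β δ))
    obtain ⟨p', q', hpq'⟩ := mem_lattice.1 (hmul δ (right_mem_lattice β δ))
    obtain ⟨nβ, hβ⟩ := F.exists_norm β
    obtain ⟨nδ, hδ⟩ := F.exists_norm δ
    obtain ⟨m, hm⟩ := F.exists_eq_add_coord (β * F.conj δ)
    change β * F.conj δ = m + F.cross β δ * F.ω at hm
    obtain ⟨t, ht⟩ := F.exists_trace F.ω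
    obtain ⟨i, j, k, l, hB⟩ := F.exists_bezout h hm hβ hδ
    have hm' := congrArg F.conj hm
    simp only [map_add, map_mul, map_intCast, F.conj_conj] at hm'
    set κ := F.cross β δ
    have hD := F.sub_conj_ω_ne_zero
    have cast_eq : ∀ {a b : ℤ}, (a : 𝓞 K) * (F.ω - F.conj F.ω) = b * (F.ω - F.conj F.ω) →
        a = b := fun h => by exact_mod_cast mul_right_cancel₀ hD h
    have hc1 := congrArg F.conj hpq
    have hc2 := congrArg F.conj hpq'
    simp only [map_add, map_mul, map_intCast] at hc1 hc2
    -- Each relation comes from multiplying `sωβ` or `sωδ` by `β̄` or `δ̄` and subtracting the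
    -- conjugate.
    have e1 : s * nβ = -q * κ := cast_eq (by
      push_cast
      rw [← hβ]
      linear_combination -F.conj β * hpq + β * hc1 + q * (hm' - hm))
    have e3 : s * nδ = p' * κ := cast_eq (by
      push_cast
      rw [← hδ]
      linear_combination -F.conj δ * hpq' + δ * hc2 + p' * (hm - hm'))
    have e2 : s * m + s * κ * t = p * κ := cast_eq (by
      push_cast
      rw [← ht]
      linear_combination -F.conj δ * hpq + δ * hc1 + (p - s * F.ω) * hm
        + (-p + s * F.conj F.ω) * hm')
    have hs : κ ∣ s := by
      refine ⟨-i * q + j * p - j * s * t + k * p' + l * s, ?_⟩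
      linear_combination -s * hB + i * e1 + j * e2 + k * e3
    have hs' : ((f : ℕ) : ℤ) ∣ s := by rw [← hf]; exact (abs_dvd _ _).2 hs
    obtain ⟨w, hw⟩ := hs'
    refine ⟨r, w * F.ω, ?_⟩
    rw [hr, hw]
    push_cast
    ring
  · intro x hx y hy
    exact F.mul_mem_lattice hf hx hy

/-- If the form vanished, `z ȳ` would be an integer for all `y, z` in the lattice. As `fω` preserves
the lattice, `fω N(y)` would be an integer, so `N(y) = 0` and `β = δ = 0`. -/
theorem cross_ne_zero_of_latticeOrder {a c β δ : 𝓞 K} (h : a * β + c * δ = 1) {f : ℕ+}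
    (hf : latticeOrder (lattice β δ) = conductorOrder K f) : F.cross β δ ≠ 0 := by
  intro h0
  obtain ⟨m, hm⟩ := F.exists_eq_add_coord (β * F.conj δ)
  change β * F.conj δ = m + F.cross β δ * F.ω at hm
  rw [h0, Int.cast_zero, zero_mul, add_zero] at hm
  have hm' := congrArg F.conj hm
  simp only [map_mul, map_intCast, F.conj_conj] at hm'
  have hmem : (((f : ℕ) : 𝓞 K) * F.ω) ∈ latticeOrder (lattice β δ) := by
    rw [hf]; exact ⟨0, F.ω, by simp⟩
  have key : ∀ y ∈ lattice β δ, (∀ z ∈ lattice β δ, ∃ n : ℤ, z * F.conj y = n) → y = 0 := by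
    intro y hy hz
    obtain ⟨n, hn⟩ := hz _ (hmem y hy)
    obtain ⟨e, he⟩ := hz y hy
    have h1 : F.coord (((f : ℕ) : 𝓞 K) * F.ω * y * F.conj y) = (f : ℕ) * e := by
      rw [mul_assoc, he]
      rw [← F.coord_add_mul 0 ((f : ℕ) * e)]
      congr 1
      push_cast
      ring
    have h2 : F.coord (((f : ℕ) : 𝓞 K) * F.ω * y * F.conj y) = 0 := by
      rw [hn, ← F.coord_add_mul n 0]
      simp
    have h3 : e = 0 := by
      rw [h1] at h2
      rcases mul_eq_zero.1 h2 with h4 | h4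
      · exact absurd h4 (by exact_mod_cast f.ne_zero)
      · exact h4
    rw [h3, Int.cast_zero, mul_eq_zero, F.conj_eq_zero, or_self] at he
    exact he
  obtain ⟨nβ, hβ⟩ := F.exists_norm β
  obtain ⟨nδ, hδ⟩ := F.exists_norm δ
  have b0 : β = 0 := key β (left_mem_lattice β δ) (by
    intro z hz
    obtain ⟨p, q, rfl⟩ := mem_lattice.1 hz
    refine ⟨p * nβ + q * m, ?_⟩
    push_cast
    rw [← hm', ← hβ]
    ring)
  have d0 : δ = 0 := key δ (right_mem_lattice β δ) (by
    intro z hz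
    obtain ⟨p, q, rfl⟩ := mem_lattice.1 hz
    refine ⟨p * m + q * nδ, ?_⟩
    push_cast
    rw [← hm, ← hδ]
    ring)
  rw [b0, d0] at h
  simp at h

/-- Comparing `ω`-coordinates, `fω ∈ O_g` forces `g ∣ f`. -/
theorem conductorOrder_injective (F : QuadraticFrame σ) :
    Function.Injective (conductorOrder K) := by
  have key : ∀ f g : ℕ+, conductorOrder K f ≤ conductorOrder K g → (g : ℕ) ∣ f := by
    intro f g h
    obtain ⟨n, y, hy⟩ := h (show ((f : ℕ) : 𝓞 K) * F.ω ∈ conductorOrder K f from ⟨0, F.ω, by simp⟩)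
    obtain ⟨m, hm⟩ := F.exists_eq_add_coord y
    have h1 := F.coord_add_mul 0 (f : ℕ)
    have h2 := F.coord_add_mul (n + (g : ℕ) * m) ((g : ℕ) * F.coord y)
    rw [← Int.natCast_dvd_natCast, ← h1]
    refine ⟨F.coord y, ?_⟩
    rw [← h2]
    congr 1
    push_cast
    rw [zero_add, hy]
    conv_lhs => rw [hm]
    ring
  intro f g h
  exact PNat.coe_injective (Nat.dvd_antisymm (key _ _ h.ge) (key _ _ h.le))

end QuadraticFrame

end

end SchmidtArrangement

/-! ### Möbius action on the Riemann sphere and curvature -/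

namespace SchmidtArrangement

noncomputable section

open Matrix

/-! ### Real points of the Riemann sphere -/

theorem infty_mem_extendedReals : (∞ : OnePoint ℂ) ∈ extendedReals := ⟨∞, rfl⟩

theorem coe_mem_extendedReals {z : ℂ} : (z : OnePoint ℂ) ∈ extendedReals ↔ z.im = 0 := by
  constructor
  · rintro ⟨x, hx⟩
    cases x with
    | infty => exact absurd hx (OnePoint.infty_ne_coe z)
    | coe x =>
      rw [OnePoint.map_some, OnePoint.coe_eq_coe] at hx
      rw [← hx, Complex.ofReal_im]
  · intro h
    exact ⟨(z.re : ℝ), by rw [OnePoint.map_some, OnePoint.coe_eq_coe]; exact Complex.ext rfl h.symm⟩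

theorem div_im_eq_zero_iff {p q : ℂ} (hq : q ≠ 0) : (p / q).im = 0 ↔ (p * star q).im = 0 := by
  have hn : Complex.normSq q ≠ 0 := by simpa using hq
  have : p / q = ((Complex.normSq q)⁻¹ : ℝ) * (p * star q) := by
    rw [div_eq_mul_inv, Complex.inv_def]
    simp only [RCLike.star_def]
    ring
  rw [this, Complex.im_ofReal_mul, mul_eq_zero, or_iff_right (inv_ne_zero hn)]

/-- Testing `p q̄` instead of `p / q` also covers `q = 0`, where the image is `∞`. -/
theorem smul_coe_mem_extendedReals (g : GL (Fin 2) ℂ) (z : ℂ) :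
    g • (z : OnePoint ℂ) ∈ extendedReals ↔
      ((g 0 0 * z + g 0 1) * star (g 1 0 * z + g 1 1)).im = 0 := by
  rw [OnePoint.smul_some_eq_ite]
  split_ifs with h
  · simp [h, infty_mem_extendedReals]
  · rw [coe_mem_extendedReals, div_im_eq_zero_iff h]

theorem smul_infty_mem_extendedReals (g : GL (Fin 2) ℂ) :
    g • (∞ : OnePoint ℂ) ∈ extendedReals ↔ (g 0 0 * star (g 1 0)).im = 0 := by
  rw [OnePoint.smul_infty_eq_ite]
  split_ifs with h
  · simp [h, infty_mem_extendedReals]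
  · rw [coe_mem_extendedReals, div_im_eq_zero_iff h]

theorem smul_mem_extendedReals {g : GL (Fin 2) ℂ} (hg : ∀ i j, (g i j).im = 0) {z : OnePoint ℂ}
    (hz : z ∈ extendedReals) : g • z ∈ extendedReals := by
  cases z with
  | infty => simp [smul_infty_mem_extendedReals, hg]
  | coe z =>
    rw [coe_mem_extendedReals] at hz
    simp [smul_coe_mem_extendedReals, hg, hz]

theorem image_smul_extendedReals {g : GL (Fin 2) ℂ} (hg : ∀ i j, (g i j).im = 0) :
    (fun z : OnePoint ℂ => g • z) '' extendedReals = extendedReals := by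
  have hdet : (g.1.det)⁻¹.im = 0 := by
    have : g.1.det.im = 0 := by
      rw [det_fin_two]
      simp [hg]
    rw [Complex.inv_im, this]
    simp
  have hinv : ∀ i j, (g⁻¹ i j).im = 0 := by
    intro i j
    rw [GeneralLinearGroup.coe_inv, Matrix.inv_def, Ring.inverse_eq_inv', adjugate_fin_two,
      Matrix.smul_apply, smul_eq_mul, Complex.mul_im, hdet]
    fin_cases i <;> fin_cases j <;> simp [hg]
  apply Set.Subset.antisymm
  · rintro _ ⟨z, hz, rfl⟩
    exact smul_mem_extendedReals hg hz
  · intro z hz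
    exact ⟨g⁻¹ • z, smul_mem_extendedReals hinv hz, smul_inv_smul g z⟩

/-- An upper triangular matrix acts on the Riemann sphere by an affine map. -/
theorem smul_of_upper_triangular {g : GL (Fin 2) ℂ} (h : g 1 0 = 0) (z : OnePoint ℂ) :
    g • z = OnePoint.map (fun w : ℂ => g 0 0 / g 1 1 * w + g 0 1 / g 1 1) z := by
  have h1 : g 1 1 ≠ 0 := by
    intro h1
    apply g.det_ne_zero
    rw [det_fin_two, h, h1]
    simp
  cases z with
  | infty => simp [OnePoint.smul_infty_eq_ite, h]
  | coe z =>
    rw [OnePoint.smul_some_eq_ite, OnePoint.map_some, h, zero_mul, zero_add, if_neg h1,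
      OnePoint.coe_eq_coe]
    field_simp

/-! ### Bianchi circles -/

section Circles

variable {K : Type*} [Field K] (σ : K →+* ℂ)

/-- The homomorphism `GL₂(𝓞 K) → GL₂(ℂ)` induced by a complex embedding of `K`. -/
def glEmb : GL (Fin 2) (𝓞 K) →* GL (Fin 2) ℂ := GeneralLinearGroup.map (intEmb σ)

theorem glEmb_apply (g : GL (Fin 2) (𝓞 K)) (i j : Fin 2) : glEmb σ g i j = intEmb σ (g i j) :=
  rfl

theorem toGL_apply (M : SpecialLinearGroup (Fin 2) (𝓞 K)) (i j : Fin 2) :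
    toGL σ M i j = intEmb σ (M i j) := rfl

theorem toGL_eq_glEmb (M : SpecialLinearGroup (Fin 2) (𝓞 K)) :
    toGL σ M = glEmb σ (SpecialLinearGroup.toGL M) := by
  ext i j
  rfl

theorem mem_circleOf (M : SpecialLinearGroup (Fin 2) (𝓞 K)) (z : OnePoint ℂ) :
    z ∈ circleOf σ M ↔ toGL σ M⁻¹ • z ∈ extendedReals := by
  have hinv : toGL σ M⁻¹ = (toGL σ M)⁻¹ := by simp [toGL_eq_glEmb]
  rw [hinv]
  constructor
  · rintro ⟨w, hw, rfl⟩
    simpa using hw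
  · intro h
    exact ⟨_, h, by simp⟩

/-- `GL₂` is needed: determinant one would only give multipliers `u` that are squares. -/
theorem affineMap_eq_smul {g : GL (Fin 2) (𝓞 K)} (h : g 1 0 = 0) {u : (𝓞 K)ˣ} {t : 𝓞 K}
    (hu : g 0 0 = u * g 1 1) (ht : g 0 1 = t * g 1 1) :
    affineMap σ u t = fun z => glEmb σ g • z := by
  funext z
  have h0 : glEmb σ g 1 0 = 0 := by rw [glEmb_apply, h, map_zero]
  have h1 : glEmb σ g 1 1 ≠ 0 := by
    intro h1
    apply (glEmb σ g).det_ne_zero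
    rw [det_fin_two, h0, h1]
    simp
  rw [smul_of_upper_triangular h0, affineMap]
  congr 1
  funext w
  rw [glEmb_apply] at h1
  rw [glEmb_apply, glEmb_apply, glEmb_apply, hu, ht, map_mul, map_mul, mul_div_assoc,
    div_self h1, mul_div_assoc, div_self h1, mul_one, mul_one]
  rfl

/-- The point `M⁻¹∞ = -δ/β` is in `ℝ̂` exactly when `βδ̄` is real. -/
theorem infty_mem_circleOf (M : SpecialLinearGroup (Fin 2) (𝓞 K)) (F : QuadraticFrame σ) :
    ∞ ∈ circleOf σ M ↔ F.cross (M 1 0) (M 1 1) = 0 := by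
  rw [mem_circleOf, smul_infty_mem_extendedReals, toGL_apply, toGL_apply,
    SpecialLinearGroup.SL2_inv_expl]
  have : intEmb σ (M 1 1) * star (intEmb σ (-M 1 0)) =
      star (intEmb σ (-(M 1 0 * F.conj (M 1 1)))) := by
    rw [map_neg, map_neg, map_mul, F.intEmb_conj]
    simp [mul_comm]
  have e : ∀ z : ℂ, (star z).im = -z.im := fun _ => rfl
  change (intEmb σ (M 1 1) * star (intEmb σ (-M 1 0))).im = 0 ↔ _
  rw [this, e, map_neg, Complex.neg_im, neg_neg, F.intEmb_im, mul_eq_zero,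
    or_iff_left F.im_pos.ne', Int.cast_eq_zero]
  rfl

theorem hasCurvature_circleOf (M : SpecialLinearGroup (Fin 2) (𝓞 K)) (F : QuadraticFrame σ) :
    HasCurvature (circleOf σ M)
      (2 * (intEmb σ F.ω).im * |(F.cross (M 1 0) (M 1 1) : ℝ)|) := by
  set α := intEmb σ (M 0 0) with hα
  set γ := intEmb σ (M 0 1) with hγ
  set β := intEmb σ (M 1 0) with hβ
  set δ := intEmb σ (M 1 1) with hδ
  have hdet : α * δ - γ * β = 1 := by
    have := congrArg (intEmb σ) ((det_fin_two M.1).symm.trans M.2)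
    rwa [map_sub, map_mul, map_mul, map_one] at this
  have im2 : ∀ w : ℂ, ((2 * w.im : ℝ) : ℂ) = -Complex.I * (w - star w) := by
    intro w
    apply Complex.ext <;> simp; ring
  have hI := Complex.I_mul_I
  have hb : (β * star δ).im = F.cross (M 1 0) (M 1 1) * (intEmb σ F.ω).im := by
    rw [hβ, hδ, ← F.intEmb_conj, ← map_mul, F.intEmb_im]
    rfl
  -- A point `z` lies on the circle when `M⁻¹z = (δz - γ)/(α - βz)` is real. These are the
  -- coefficients of `i(w - w̄)` for `w = (δz - γ)` times the conjugate of `α - βz`; the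
  -- normalisation `b'b = |a|² - 1` is `|det M|² = 1`.
  refine ⟨2 * (δ * star β).im, 2 * (γ * star α).im, Complex.I * (star δ * α - γ * star β),
    ?_, ?_, ?_, ?_⟩
  · have hdet' := congrArg star hdet
    apply Complex.ofReal_injective
    rw [Complex.ofReal_mul, Complex.ofReal_sub, im2, im2, Complex.normSq_eq_conj_mul_self,
      starRingEnd_apply]
    simp only [star_sub, star_mul', star_one, RCLike.star_def, Complex.conj_I, Complex.conj_conj,
      Complex.ofReal_one] at hdet' ⊢
    generalize (starRingEnd ℂ) α = α' at *
    generalize (starRingEnd ℂ) β = β' at *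
    generalize (starRingEnd ℂ) γ = γ' at *
    generalize (starRingEnd ℂ) δ = δ' at *
    linear_combination ((γ * α' - γ' * α) * (δ * β' - δ' * β)
      + (δ * α' - γ' * β) * (δ' * α - γ * β')) * hI - (α' * δ' - γ' * β') * hdet - hdet'
  · have : (δ * star β).im = -(β * star δ).im := by simp; ring
    rw [this, hb, abs_mul, abs_neg, abs_mul, abs_of_pos F.im_pos, abs_two]
    ring
  · rw [infty_mem_circleOf σ M F]
    have : (δ * star β).im = -(β * star δ).im := by simp; ring
    rw [this, hb]
    simp [F.im_pos.ne']
  · intro z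
    rw [mem_circleOf, smul_coe_mem_extendedReals, SpecialLinearGroup.SL2_inv_expl]
    change ((intEmb σ (M 1 1) * z + intEmb σ (-M 0 1)) *
      star (intEmb σ (-M 1 0) * z + intEmb σ (M 0 0))).im = 0 ↔ _
    rw [map_neg, map_neg, ← hα, ← hβ, ← hγ, ← hδ]
    have key : ∀ w : ℂ, w.im = 0 ↔ Complex.I * (w - star w) = 0 := by
      intro w
      rw [mul_eq_zero, or_iff_right Complex.I_ne_zero, sub_eq_zero, ← Complex.conj_eq_iff_im,
        eq_comm]
      rfl
    rw [key, im2, im2]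
    simp only [star_sub, star_add, star_neg, star_mul', RCLike.star_def, Complex.conj_I,
      Complex.conj_conj]
    ring_nf

end Circles

end

end SchmidtArrangement

/-! ### Equivalent circles and homothetic lattices -/

namespace SchmidtArrangement

noncomputable section

open Matrix

variable {K : Type*} [Field K] {σ : K →+* ℂ}

theorem det_eq_one (M : SpecialLinearGroup (Fin 2) (𝓞 K)) :
    M 0 0 * M 1 1 - M 0 1 * M 1 0 = 1 :=
  (det_fin_two M.1).symm.trans M.2

theorem bezout_row (M : SpecialLinearGroup (Fin 2) (𝓞 K)) :
    -M 0 1 * M 1 0 + M 0 0 * M 1 1 = 1 := by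
  linear_combination det_eq_one M

/-- An invertible change of basis does not change a lattice. -/
theorem mem_lattice_change_basis {β δ μ : 𝓞 K} {p q r s : ℤ} (h : IsUnit (p * s - q * r))
    {x : 𝓞 K} : x ∈ lattice (μ * ((p : 𝓞 K) * β + (r : 𝓞 K) * δ))
      (μ * ((q : 𝓞 K) * β + (s : 𝓞 K) * δ)) ↔
      ∃ y ∈ lattice β δ, μ * y = x := by
  have he : (p * s - q * r) * (p * s - q * r) = 1 := Int.isUnit_mul_self h
  set e := p * s - q * r with hedef
  have he' : (e : 𝓞 K) * e = 1 := by rw [← Int.cast_mul, he, Int.cast_one]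
  have hedef' : (e : 𝓞 K) = p * s - q * r := by rw [hedef]; push_cast; ring
  constructor
  · intro hx
    obtain ⟨a, b, rfl⟩ := mem_lattice.1 hx
    refine ⟨_, mem_lattice.2 ⟨a * p + b * q, a * r + b * s, rfl⟩, ?_⟩
    push_cast
    ring
  · rintro ⟨y, hy, rfl⟩
    obtain ⟨a, b, rfl⟩ := mem_lattice.1 hy
    refine mem_lattice.2 ⟨e * (s * a - q * b), e * (p * b - r * a), ?_⟩
    push_cast
    linear_combination -e * μ * (a * β + b * δ) * hedef' + μ * (a * β + b * δ) * he'

theorem QuadraticFrame.mul_conj_eq_of_im_eq_zero (F : QuadraticFrame σ) {x y : 𝓞 K}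
    (h : (intEmb σ x * star (intEmb σ y)).im = 0) :
    x * F.conj y = F.conj x * y := by
  apply intEmb_injective σ
  rw [map_mul, map_mul, F.intEmb_conj, F.intEmb_conj]
  have : star (intEmb σ x * star (intEmb σ y)) = _ := Complex.conj_eq_iff_im.2 h
  rw [← this, star_mul', star_star]

variable [NumberField K]

namespace QuadraticFrame

variable (F : QuadraticFrame σ)

/-- The elements of `𝓞 K` on a fixed real line through the origin are the integral multiples of
one of them. -/
theorem exists_generator_of_line {y₀ : 𝓞 K} (h₀ : y₀ ≠ 0) :
    ∃ μ : 𝓞 K, ∀ y, y * F.conj y₀ = F.conj y * y₀ → ∃ n : ℤ, y = n * μ := by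
  have hc : F.conj y₀ ≠ 0 := fun h => h₀ (F.conj_eq_zero.1 h)
  -- An element `y` of the line is determined by the integer `y ȳ₀`, and a subgroup of `ℤ` is
  -- cyclic.
  let S : AddSubgroup ℤ :=
    { carrier := {n | ∃ y, y * F.conj y₀ = n}
      zero_mem' := ⟨0, by simp⟩
      add_mem' := by
        rintro a b ⟨x, hx⟩ ⟨y, hy⟩
        exact ⟨x + y, by push_cast; rw [← hx, ← hy]; ring⟩
      neg_mem' := by
        rintro a ⟨x, hx⟩
        exact ⟨-x, by push_cast; rw [← hx]; ring⟩ }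
  obtain ⟨g, hg⟩ := Int.subgroup_cyclic S
  rw [← AddSubgroup.zmultiples_eq_closure] at hg
  obtain ⟨μ, hμ⟩ : g ∈ S := hg ▸ AddSubgroup.mem_zmultiples g
  refine ⟨μ, fun y hy => ?_⟩
  obtain ⟨n, hn⟩ := F.exists_intCast_of_conj_eq (x := y * F.conj y₀) (by
    rw [map_mul, F.conj_conj, hy])
  have hnS : n ∈ S := ⟨y, hn⟩
  rw [hg, AddSubgroup.mem_zmultiples_iff] at hnS
  obtain ⟨k, hk⟩ := hnS
  refine ⟨k, mul_right_cancel₀ hc ?_⟩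
  rw [hn, mul_assoc, hμ, ← hk]
  simp

/-- A matrix of `GL₂(𝓞 K)` preserving the extended real line is the product of a unit and a matrix
of `GL₂(ℤ)`. -/
theorem exists_unit_mul_integral (F : QuadraticFrame σ) {N : GL (Fin 2) (𝓞 K)}
    (hN : ∀ z ∈ extendedReals, glEmb σ N • z ∈ extendedReals) :
    ∃ (μ : (𝓞 K)ˣ) (p q r s : ℤ), IsUnit (p * s - q * r) ∧
      N 0 0 = p * μ ∧ N 0 1 = q * μ ∧ N 1 0 = r * μ ∧ N 1 1 = s * μ := by
  set p := N 0 0 with hp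
  set q := N 0 1 with hq
  set r := N 1 0 with hr
  set s := N 1 1 with hs
  have hdet : IsUnit (p * s - q * r) := by
    rw [hp, hq, hr, hs, ← det_fin_two]
    exact ⟨GeneralLinearGroup.det N, rfl⟩
  -- The images of `∞`, `0` and `1` are real.
  have e1 : p * F.conj r = F.conj p * r := F.mul_conj_eq_of_im_eq_zero (by
    simpa [smul_infty_mem_extendedReals, glEmb_apply] using hN ∞ infty_mem_extendedReals)
  have e2 : q * F.conj s = F.conj q * s := F.mul_conj_eq_of_im_eq_zero (by
    simpa [smul_coe_mem_extendedReals, glEmb_apply] using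
      hN (0 : ℂ) (coe_mem_extendedReals.2 (by simp)))
  have e3 : (p + q) * F.conj (r + s) = F.conj (p + q) * (r + s) := F.mul_conj_eq_of_im_eq_zero (by
    have := hN (1 : ℂ) (coe_mem_extendedReals.2 (by simp))
    rw [smul_coe_mem_extendedReals] at this
    simpa only [glEmb_apply, mul_one, map_add] using this)
  simp only [map_add] at e3
  set D := p * s - q * r with hD
  -- Three real values determine a Möbius map, so the conjugate of `N` is proportional to `N`, with
  -- ratio `X / D`. All entries of `N` thus lie on one real line through the origin.
  set X := F.conj p * s - q * F.conj r with hX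
  have fp : F.conj p * D = X * p := by rw [hD, hX]; linear_combination q * e1
  have fr : F.conj r * D = X * r := by rw [hD, hX]; linear_combination s * e1
  have fq : F.conj q * D = X * q := by
    rw [hD, hX]; linear_combination -p * e2 + q * (e3 - e1 - e2)
  have fs : F.conj s * D = X * s := by
    rw [hD, hX]; linear_combination -r * e2 + s * (e3 - e1 - e2)
  have hD0 : D ≠ 0 := hdet.ne_zero
  have pair : ∀ {y z : 𝓞 K}, F.conj y * D = X * y → F.conj z * D = X * z →
      y * F.conj z = F.conj y * z := by
    intro y z hy hz
    apply mul_right_cancel₀ hD0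
    linear_combination y * hz - z * hy
  obtain ⟨y₀, h₀, hy₀⟩ : ∃ y₀ : 𝓞 K, y₀ ≠ 0 ∧ F.conj y₀ * D = X * y₀ := by
    by_cases h : p = 0
    · refine ⟨q, fun h' => hD0 ?_, fq⟩
      rw [hD, h, h']
      ring
    · exact ⟨p, h, fp⟩
  obtain ⟨μ, hμ⟩ := F.exists_generator_of_line h₀
  obtain ⟨p', hp'⟩ := hμ p (pair fp hy₀)
  obtain ⟨q', hq'⟩ := hμ q (pair fq hy₀)
  obtain ⟨r', hr'⟩ := hμ r (pair fr hy₀)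
  obtain ⟨s', hs'⟩ := hμ s (pair fs hy₀)
  -- The determinant is a unit, so both `μ` and the integral determinant are units.
  have hprod : D = μ * μ * ((p' * s' - q' * r' : ℤ) : 𝓞 K) := by
    rw [hD, hp', hq', hr', hs']
    push_cast
    ring
  rw [hprod] at hdet
  have hμu : IsUnit μ := isUnit_of_mul_isUnit_left (isUnit_of_mul_isUnit_left hdet)
  have hiu : IsUnit (algebraMap ℤ (𝓞 K) (p' * s' - q' * r')) := by
    simpa using isUnit_of_mul_isUnit_right hdet
  exact ⟨hμu.unit, p', q', r', s', isUnit_of_map_unit _ _ hiu, hp', hq', hr', hs'⟩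

/-- Equivalent circles have homothetic lattices. -/
theorem exists_unit_of_circleEquiv (F : QuadraticFrame σ) {M M' : SpecialLinearGroup (Fin 2) (𝓞 K)}
    (h : CircleEquiv σ (circleOf σ M) (circleOf σ M')) :
    ∃ μ : (𝓞 K)ˣ, ∀ x, x ∈ lattice (M' 1 0) (M' 1 1) ↔
      ∃ y ∈ lattice (M 1 0) (M 1 1), (μ : 𝓞 K) * y = x := by
  obtain ⟨u, t, hut⟩ := h
  let A : GL (Fin 2) (𝓞 K) := GeneralLinearGroup.mk'' !![(u : 𝓞 K), t; 0, 1] (by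
    simp [det_fin_two])
  have hA : affineMap σ u t = fun z => glEmb σ A • z :=
    affineMap_eq_smul σ (by simp [A]) (by simp [A]) (by simp [A])
  let m : GL (Fin 2) (𝓞 K) := SpecialLinearGroup.toGL M
  let m' : GL (Fin 2) (𝓞 K) := SpecialLinearGroup.toGL M'
  -- `N` preserves `ℝ̂` because `A` carries one circle to the other. The bottom row of `A` is `(0,
  -- 1)`, so the bottom row of `M'` is that of `M` times `N`.
  obtain ⟨N, hNdef⟩ : ∃ N, N = m⁻¹ * A⁻¹ * m' := ⟨_, rfl⟩
  have hm' : m' = A * m * N := by rw [hNdef]; group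
  have hN : ∀ z ∈ extendedReals, glEmb σ N • z ∈ extendedReals := by
    intro z hz
    have h1 : toGL σ M' • z ∈ circleOf σ M' := ⟨z, hz, rfl⟩
    rw [← hut, hA] at h1
    obtain ⟨_, ⟨w, hw, rfl⟩, h2⟩ := h1
    have h3 : glEmb σ N • z = w := by
      rw [toGL_eq_glEmb, toGL_eq_glEmb] at h2
      change glEmb σ A • glEmb σ m • w = glEmb σ m' • z at h2
      rw [hNdef, map_mul, map_mul, mul_smul, mul_smul, ← h2]
      simp
    rw [h3]
    exact hw
  obtain ⟨μ, p, q, r, s, hu, hp, hq, hr, hs⟩ := F.exists_unit_mul_integral hN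
  refine ⟨μ, fun x => ?_⟩
  have row : ∀ j, M' 1 j = M 1 0 * N 0 j + M 1 1 * N 1 j := by
    intro j
    have : m' 1 j = (A * m * N) 1 j := by rw [← hm']
    rw [GeneralLinearGroup.coe_mul, GeneralLinearGroup.coe_mul, mul_apply, Fin.sum_univ_two,
      mul_apply, mul_apply, Fin.sum_univ_two, Fin.sum_univ_two] at this
    simpa [A, m, m'] using this
  rw [← mem_lattice_change_basis hu, row, row, hp, hq, hr, hs]
  have e1 : M 1 0 * (p * μ) + M 1 1 * (r * μ) = (μ : 𝓞 K) * (p * M 1 0 + r * M 1 1) := by ring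
  have e2 : M 1 0 * (q * μ) + M 1 1 * (s * μ) = (μ : 𝓞 K) * (q * M 1 0 + s * M 1 1) := by ring
  rw [e1, e2]

/-- Circles with homothetic lattices are equivalent. -/
theorem circleEquiv_of_lattice {M M' : SpecialLinearGroup (Fin 2) (𝓞 K)} (l : (𝓞 K)ˣ)
    (hl : ∀ x ∈ lattice (M' 1 0) (M' 1 1), ∃ y ∈ lattice (M 1 0) (M 1 1), (l : 𝓞 K) * y = x)
    (h0 : F.cross (M 1 0) (M 1 1) ≠ 0)
    (hcross : |F.cross (M 1 0) (M 1 1)| = |F.cross (M' 1 0) (M' 1 1)|) :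
    CircleEquiv σ (circleOf σ M) (circleOf σ M') := by
  obtain ⟨_, hy1, hb⟩ := hl _ (left_mem_lattice _ _)
  obtain ⟨_, hy2, hd⟩ := hl _ (right_mem_lattice _ _)
  obtain ⟨p, q, rfl⟩ := mem_lattice.1 hy1
  obtain ⟨r, s, rfl⟩ := mem_lattice.1 hy2
  obtain ⟨n, hn⟩ := F.exists_norm (l : 𝓞 K)
  -- The form scales by the norm of `l` and the determinant of the change of basis; equal nonzero
  -- absolute values make this determinant `±1`.
  have hc : F.cross (M' 1 0) (M' 1 1) = n * (p * s - q * r) * F.cross (M 1 0) (M 1 1) := by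
    apply F.cross_eq
    rw [← hb, ← hd]
    push_cast
    rw [← hn]
    simp only [map_mul, map_add, map_intCast]
    linear_combination -l * F.conj l * (p * s - q * r) * F.cross_mul (M 1 0) (M 1 1)
  have hu : IsUnit (p * s - q * r) := by
    rw [hc, abs_mul] at hcross
    have h1 : |n * (p * s - q * r)| = 1 := by
      have h0' := abs_ne_zero.2 h0
      apply mul_right_cancel₀ h0'
      rw [← hcross, one_mul]
    exact isUnit_of_mul_isUnit_right (Int.isUnit_iff_abs_eq.2 h1)
  set e := p * s - q * r with he
  have he' : (e : 𝓞 K) = p * s - q * r := by rw [he]; push_cast; ring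
  have hee : (e : 𝓞 K) * e = 1 := by exact_mod_cast Int.isUnit_mul_self hu
  have hli : (l : 𝓞 K) * (l⁻¹ : (𝓞 K)ˣ) = 1 := l.mul_inv
  let eu : (𝓞 K)ˣ := ⟨e, e, hee, hee⟩
  let N : GL (Fin 2) (𝓞 K) := GeneralLinearGroup.mk'' !![(p : 𝓞 K), (r : 𝓞 K); (q : 𝓞 K), (s : 𝓞 K)]
    (by rw [det_fin_two_of]; convert eu.isUnit using 1; simp only [eu]; rw [he']; ring)
  -- Upper right entry of `M' (M N)⁻¹`, the only possible `A`; its bottom row is `(0, l)` and its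
  -- determinant `e`.
  set y : 𝓞 K := e * (-(M' 0 0) * (M 0 0 * r + M 0 1 * s) + M' 0 1 * (M 0 0 * p + M 0 1 * q))
    with hy
  let A : GL (Fin 2) (𝓞 K) := GeneralLinearGroup.mk''
    !![((eu * l⁻¹ : (𝓞 K)ˣ) : 𝓞 K), y; 0, (l : 𝓞 K)]
    (by rw [det_fin_two_of, mul_zero, sub_zero]; exact (eu * l⁻¹ * l).isUnit)
  have hdM := det_eq_one M
  have hdM' := det_eq_one M'
  set L : 𝓞 K := ((l⁻¹ : (𝓞 K)ˣ) : 𝓞 K)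
  have hdiag : ∀ w : 𝓞 K, L * w = w * (M' 0 0 * (r * M 1 0 + s * M 1 1)
      - M' 0 1 * (p * M 1 0 + q * M 1 1)) := by
    intro w
    linear_combination -(L * w) * hdM' - L * w * M' 0 0 * hd + L * w * M' 0 1 * hb
      + w * (M' 0 0 * (r * M 1 0 + s * M 1 1) - M' 0 1 * (p * M 1 0 + q * M 1 1)) * hli
  have hdet : (M 0 0 * p + M 0 1 * q) * (r * M 1 0 + s * M 1 1)
      - (M 0 0 * r + M 0 1 * s) * (p * M 1 0 + q * M 1 1) = (e : 𝓞 K) := by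
    linear_combination (p * s - q * r) * hdM - he'
  have hprod : SpecialLinearGroup.toGL M' = A * SpecialLinearGroup.toGL M * N := by
    refine GeneralLinearGroup.ext fun i j => ?_
    rw [GeneralLinearGroup.coe_mul, GeneralLinearGroup.coe_mul, mul_apply, Fin.sum_univ_two,
      mul_apply, mul_apply, Fin.sum_univ_two, Fin.sum_univ_two]
    fin_cases i <;> fin_cases j
    · simp [A, N, eu]
      linear_combination -e * hdiag (M 0 0 * p + M 0 1 * q) - M' 0 0 * e * hdet - M' 0 0 * hee
        - (p * M 1 0 + q * M 1 1) * hy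
    · simp [A, N, eu]
      linear_combination -e * hdiag (M 0 0 * r + M 0 1 * s) - M' 0 1 * e * hdet - M' 0 1 * hee
        - (r * M 1 0 + s * M 1 1) * hy
    · simp [A, N, eu]
      rw [← hb]; ring
    · simp [A, N, eu]
      rw [← hd]; ring
  refine ⟨eu * l⁻¹ * l⁻¹, y * (l⁻¹ : (𝓞 K)ˣ), ?_⟩
  have hA : affineMap σ (eu * l⁻¹ * l⁻¹) (y * (l⁻¹ : (𝓞 K)ˣ)) = fun z => glEmb σ A • z :=
    affineMap_eq_smul σ (by simp [A]) (by simp [A]) (by simp [A])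
  have hreal := image_smul_extendedReals (g := glEmb σ N) (by
    intro i j
    rw [glEmb_apply]
    fin_cases i <;> fin_cases j <;> simp [N])
  rw [hA, circleOf, circleOf, toGL_eq_glEmb, toGL_eq_glEmb, hprod]
  conv_lhs => rw [← hreal]
  rw [Set.image_image, Set.image_image]
  simp only [map_mul, mul_smul]

end QuadraticFrame

end

end SchmidtArrangement

/-! ### Ideal classes computed in an arbitrary fraction field -/

namespace FractionalIdeal

/-- Seen as extension along the identity, a change of fraction field composes with extension of
ideals through `extended_extended`. -/
theorem canonicalEquiv_eq_extended {R : Type*} [CommRing R] {S : Submonoid R} (P P' : Type*)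
    [CommRing P] [Algebra R P] [IsLocalization S P] [CommRing P'] [Algebra R P']
    [IsLocalization S P'] (I : FractionalIdeal S P) :
    canonicalEquiv S P P' I = I.extended P' (f := RingHom.id R)
      (le_of_eq (Submonoid.comap_id S).symm) := by
  ext x
  rw [mem_extended_iff, mem_canonicalEquiv_apply]
  constructor
  · rintro ⟨y, hy, rfl⟩
    exact Submodule.subset_span ⟨y, hy, rfl⟩
  · intro hx
    induction hx using Submodule.span_induction with
    | mem x h => obtain ⟨y, hy, rfl⟩ := h; exact ⟨y, hy, rfl⟩
    | zero => exact ⟨0, zero_mem I, map_zero _⟩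
    | add x y _ _ hx hy =>
      obtain ⟨a, ha, rfl⟩ := hx
      obtain ⟨b, hb, rfl⟩ := hy
      exact ⟨a + b, I.val.add_mem ha hb, map_add _ _ _⟩
    | smul r x _ hx =>
      obtain ⟨a, ha, rfl⟩ := hx
      refine ⟨r • a, I.val.smul_mem r ha, ?_⟩
      exact IsLocalization.map_smul (le_of_eq (Submonoid.comap_id S).symm) a r

end FractionalIdeal

namespace ClassGroup

open FractionalIdeal

/-- Extension of ideal classes, computed on fractional ideals in arbitrary fraction fields. -/
theorem extendedHom_mk_of_isFractionRing {A B : Type*} [CommRing A] [IsDomain A] [CommRing B]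
    [IsDomain B] [Algebra A B] [Module.IsTorsionFree A B] (K L : Type*) [Field K] [Field L]
    [Algebra A K] [Algebra B L] [IsFractionRing A K] [IsFractionRing B L]
    (I : (FractionalIdeal A⁰ K)ˣ) :
    ClassGroup.extendedHom A B (ClassGroup.mk K I) =
      ClassGroup.mk L (Units.map (FractionalIdeal.extendedHom L B).toMonoidHom I) := by
  rw [← ClassGroup.mk_canonicalEquiv K (FractionRing A), ClassGroup.extendedHom_mk,
    ← ClassGroup.mk_canonicalEquiv L (FractionRing B)]
  congr 1
  apply Units.ext
  change FractionalIdeal.extendedHom (FractionRing B) B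
      (canonicalEquiv A⁰ K (FractionRing A) (I : FractionalIdeal A⁰ K)) =
    canonicalEquiv B⁰ L (FractionRing B)
      (FractionalIdeal.extendedHom L B (I : FractionalIdeal A⁰ K))
  rw [canonicalEquiv_eq_extended, canonicalEquiv_eq_extended, extendedHom'_apply,
    extendedHom'_apply, extended_extended, extended_extended]

theorem mk_eq_mk_iff_exists_spanSingleton {R K : Type*} [CommRing R] [IsDomain R] [Field K]
    [Algebra R K] [IsFractionRing R K] {I J : (FractionalIdeal R⁰ K)ˣ} :
    ClassGroup.mk K I = ClassGroup.mk K J ↔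
      ∃ x : K, x ≠ 0 ∧ spanSingleton R⁰ x * (I : FractionalIdeal R⁰ K) = J := by
  constructor
  · intro h
    have h1 : ClassGroup.mk K (J * I⁻¹) = 1 := by
      rw [map_mul, map_inv, h, mul_inv_cancel]
    rw [ClassGroup.mk_eq_one_iff] at h1
    obtain ⟨x, hx⟩ := h1.principal
    have h2 : ((J * I⁻¹ : (FractionalIdeal R⁰ K)ˣ) : FractionalIdeal R⁰ K) =
        spanSingleton R⁰ x := by
      apply coeToSubmodule_injective
      exact hx.trans (coe_spanSingleton _ _).symm
    have h3 : spanSingleton R⁰ x * (I : FractionalIdeal R⁰ K) = J := by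
      rw [← h2, ← Units.val_mul, inv_mul_cancel_right]
    refine ⟨x, ?_, h3⟩
    rintro rfl
    rw [spanSingleton_zero, zero_mul] at h3
    exact J.ne_zero h3.symm
  · rintro ⟨x, hx, h⟩
    have h1 : J = toPrincipalIdeal R K (Units.mk0 x hx) * I := by
      apply Units.ext
      rw [Units.val_mul, coe_toPrincipalIdeal, Units.val_mk0, h]
    have h2 : ClassGroup.mk K (toPrincipalIdeal R K (Units.mk0 x hx)) = 1 := by
      rw [ClassGroup.mk_eq_one_iff, coe_toPrincipalIdeal, coe_spanSingleton]
      exact ⟨⟨_, rfl⟩⟩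
    rw [h1, map_mul, h2, one_mul]

end ClassGroup

/-! ### The lattice as an invertible ideal with trivial extension -/

namespace SchmidtArrangement

noncomputable section

open FractionalIdeal

variable {K : Type*} [Field K]

theorem coe_ringOfIntegers_add (x y : 𝓞 K) : ((x + y : 𝓞 K) : K) = x + y :=
  map_add (algebraMap (𝓞 K) K) x y

theorem coe_ringOfIntegers_mul (x y : 𝓞 K) : ((x * y : 𝓞 K) : K) = x * y :=
  map_mul (algebraMap (𝓞 K) K) x y

theorem coe_ringOfIntegers_one : ((1 : 𝓞 K) : K) = 1 :=
  map_one (algebraMap (𝓞 K) K)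

theorem algebraMap_conductorOrder {f : ℕ+} (a : conductorOrder K f) :
    algebraMap (conductorOrder K f) K a = ((a : 𝓞 K) : K) := rfl

theorem smul_conductorOrder {f : ℕ+} (a : conductorOrder K f) (x : K) :
    a • x = ((a : 𝓞 K) : K) * x := rfl

variable [NumberField K]

instance conductorOrder_isIntegral (f : ℕ+) : Algebra.IsIntegral (conductorOrder K f) (𝓞 K) :=
  Algebra.IsIntegral.tower_top ℤ

theorem theta_mk {f : ℕ+} (I : (FractionalIdeal (conductorOrder K f)⁰ K)ˣ) :
    theta K f (ClassGroup.mk K I) =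
      ClassGroup.mk K (Units.map (FractionalIdeal.extendedHom K (𝓞 K)).toMonoidHom I) :=
  ClassGroup.extendedHom_mk_of_isFractionRing K K I

/-- A lattice in `𝓞 K` preserved by an order, as a fractional ideal of this order. -/
def latticeIdeal (Λ : Submodule ℤ (𝓞 K)) (f : ℕ+)
    (h : ∀ x ∈ conductorOrder K f, ∀ y ∈ Λ, x * y ∈ Λ) :
    FractionalIdeal (conductorOrder K f)⁰ K :=
  ⟨{ carrier := {x | ∃ y ∈ Λ, (y : K) = x}
     zero_mem' := ⟨0, Λ.zero_mem, by simp⟩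
     add_mem' := by
       rintro _ _ ⟨x, hx, rfl⟩ ⟨y, hy, rfl⟩
       exact ⟨x + y, Λ.add_mem hx hy, by simp⟩
     smul_mem' := by
       rintro a _ ⟨y, hy, rfl⟩
       exact ⟨a * y, h a a.2 y hy, by rw [smul_conductorOrder]; simp⟩ }, by
    have hf : ∀ y : 𝓞 K, ((f : ℕ) : 𝓞 K) * y ∈ conductorOrder K f := fun y => ⟨0, y, by simp⟩
    -- The conductor is a common denominator, as `f 𝓞 K ⊆ O_f`.
    refine ⟨⟨((f : ℕ) : 𝓞 K), (mul_one ((f : ℕ) : 𝓞 K)) ▸ hf 1⟩, ?_, ?_⟩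
    · rw [mem_nonZeroDivisors_iff_ne_zero]
      intro h0
      have : ((f : ℕ) : 𝓞 K) = 0 := congrArg Subtype.val h0
      exact f.ne_zero (by exact_mod_cast this)
    · rintro _ ⟨y, -, rfl⟩
      exact ⟨⟨_, hf y⟩, by rw [algebraMap_conductorOrder, smul_conductorOrder]; simp⟩⟩

theorem mem_latticeIdeal {Λ : Submodule ℤ (𝓞 K)} {f : ℕ+}
    {h : ∀ x ∈ conductorOrder K f, ∀ y ∈ Λ, x * y ∈ Λ} {x : K} :
    x ∈ latticeIdeal Λ f h ↔ ∃ y ∈ Λ, (y : K) = x := Iff.rfl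

namespace QuadraticFrame

variable {σ : K →+* ℂ} (F : QuadraticFrame σ)

/-- A lattice generating the unit ideal is inverse to its complex conjugate. -/
theorem latticeIdeal_mul_conj {a c β δ : 𝓞 K} (h : a * β + c * δ = 1) {f : ℕ+}
    (hf : |F.cross β δ| = (f : ℕ))
    (h1 : ∀ x ∈ conductorOrder K f, ∀ y ∈ lattice β δ, x * y ∈ lattice β δ)
    (h2 : ∀ x ∈ conductorOrder K f, ∀ y ∈ lattice (F.conj β) (F.conj δ),
      x * y ∈ lattice (F.conj β) (F.conj δ)) :
    latticeIdeal (lattice β δ) f h1 * latticeIdeal (lattice (F.conj β) (F.conj δ)) f h2 = 1 := by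
  obtain ⟨nβ, hβ⟩ := F.exists_norm β
  obtain ⟨nδ, hδ⟩ := F.exists_norm δ
  obtain ⟨m, hm⟩ := F.exists_eq_add_coord (β * F.conj δ)
  change β * F.conj δ = m + F.cross β δ * F.ω at hm
  have hm' := congrArg F.conj hm
  simp only [map_add, map_mul, map_intCast, F.conj_conj] at hm'
  have hcross : ∃ ε : ℤ, F.cross β δ = (f : ℕ) * ε := by
    rw [← hf]
    exact (abs_dvd _ _).2 dvd_rfl
  apply le_antisymm
  · rw [FractionalIdeal.mul_le]
    rintro _ ⟨x, hx, rfl⟩ _ ⟨y, hy, rfl⟩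
    obtain ⟨p, q, rfl⟩ := mem_lattice.1 hx
    obtain ⟨r, s, rfl⟩ := mem_lattice.1 hy
    obtain ⟨ε, hε⟩ := hcross
    rw [mem_one_iff]
    have hmem : ((p : 𝓞 K) * β + q * δ) * (r * F.conj β + s * F.conj δ) ∈ conductorOrder K f := by
      refine ⟨p * r * nβ + (p * s + q * r) * m + q * s * nδ,
        ε * (p * s * F.ω + q * r * F.conj F.ω), ?_⟩
      rw [hε] at hm hm'
      push_cast at hm hm' ⊢
      rw [← hβ, ← hδ]
      linear_combination p * s * hm + q * r * hm'
    exact ⟨⟨_, hmem⟩, by rw [algebraMap_conductorOrder]; simp⟩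
  · rw [FractionalIdeal.one_le]
    set J := latticeIdeal (lattice β δ) f h1 * latticeIdeal (lattice (F.conj β) (F.conj δ)) f h2
      with hJ
    have mulmem : ∀ {x y : 𝓞 K}, x ∈ lattice β δ → y ∈ lattice (F.conj β) (F.conj δ) →
        ((x * y : 𝓞 K) : K) ∈ J := by
      intro x y hx hy
      rw [coe_ringOfIntegers_mul]
      exact FractionalIdeal.mul_mem_mul ⟨x, hx, rfl⟩ ⟨y, hy, rfl⟩
    have zmem : ∀ (n : ℤ) {x : 𝓞 K}, (x : K) ∈ J → ((n * x : 𝓞 K) : K) ∈ J := by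
      intro n x hx
      have := J.val.toAddSubgroup.zsmul_mem hx n
      rw [zsmul_eq_mul] at this
      rw [show ((n * x : 𝓞 K) : K) = n * x by simp]
      exact this
    have addmem : ∀ {x y : 𝓞 K}, (x : K) ∈ J → (y : K) ∈ J → ((x + y : 𝓞 K) : K) ∈ J := by
      intro x y hx hy
      rw [coe_ringOfIntegers_add]
      exact J.val.add_mem hx hy
    -- Here `κ 𝓞 K ⊆ Λ` and `Λ̄` generates the unit ideal, so `κ 𝓞 K ⊆ Λ Λ̄`; the Bézout identity
    -- then puts `1` in the product.
    have hk : ∀ x : 𝓞 K, ((F.cross β δ * x : 𝓞 K) : K) ∈ J := by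
      intro x
      have h' := congrArg F.conj h
      simp only [map_add, map_mul, map_one] at h'
      have e : (F.cross β δ : 𝓞 K) * x = (F.cross β δ * (x * F.conj a)) * F.conj β
          + (F.cross β δ * (x * F.conj c)) * F.conj δ := by
        linear_combination -F.cross β δ * x * h'
      rw [e]
      exact addmem (mulmem (F.cross_mul_mem_lattice _ _ _) (left_mem_lattice _ _))
        (mulmem (F.cross_mul_mem_lattice _ _ _) (right_mem_lattice _ _))
    obtain ⟨i, j, k, l, hB⟩ := F.exists_bezout h hm hβ hδ
    have hmm : ((m : 𝓞 K) : K) ∈ J := by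
      have e : (m : 𝓞 K) = β * F.conj δ + F.cross β δ * (-F.ω) := by rw [hm]; ring
      rw [e]
      exact addmem (mulmem (left_mem_lattice _ _) (right_mem_lattice _ _)) (hk _)
    have hnβ : ((nβ : 𝓞 K) : K) ∈ J :=
      hβ ▸ mulmem (left_mem_lattice _ _) (left_mem_lattice _ _)
    have hnδ : ((nδ : 𝓞 K) : K) ∈ J :=
      hδ ▸ mulmem (right_mem_lattice _ _) (right_mem_lattice _ _)
    have e : (1 : 𝓞 K) = i * nβ + j * m + k * nδ + F.cross β δ * l := by
      have := congrArg (Int.cast : ℤ → 𝓞 K) hB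
      push_cast at this
      linear_combination -this
    rw [← map_one (algebraMap (𝓞 K) K), e]
    exact addmem (addmem (addmem (zmem _ hnβ) (zmem _ hmm)) (zmem _ hnδ)) (hk _)

end QuadraticFrame

theorem coe_mem_extendedHom {f : ℕ+} {I : FractionalIdeal (conductorOrder K f)⁰ K} {x : K}
    (hx : x ∈ I) : x ∈ FractionalIdeal.extendedHom K (𝓞 K) I := by
  rw [← FractionalIdeal.mem_coe, coe_extendedHom_eq_span]
  exact Submodule.subset_span ⟨x, hx, rfl⟩

theorem extendedHom_eq_one {f : ℕ+} {I : FractionalIdeal (conductorOrder K f)⁰ K}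
    (hI : ∀ x ∈ I, ∃ y : 𝓞 K, (y : K) = x) {a c β δ : 𝓞 K} (h : a * β + c * δ = 1)
    (hβ : (β : K) ∈ I) (hδ : (δ : K) ∈ I) : FractionalIdeal.extendedHom K (𝓞 K) I = 1 := by
  apply le_antisymm
  · intro x hx
    rw [← FractionalIdeal.mem_coe, coe_extendedHom_eq_span] at hx
    have : Submodule.span (𝓞 K) (algebraMap K K '' I) ≤
        ((1 : FractionalIdeal (𝓞 K)⁰ K) : Submodule (𝓞 K) K) := by
      rw [Submodule.span_le]
      rintro _ ⟨z, hz, rfl⟩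
      obtain ⟨y, rfl⟩ := hI z hz
      exact (mem_one_iff _).2 ⟨y, rfl⟩
    exact this hx
  · rw [FractionalIdeal.one_le, ← map_one (algebraMap (𝓞 K) K), ← h, map_add, map_mul, map_mul]
    have := Submodule.add_mem (FractionalIdeal.extendedHom K (𝓞 K) I).val
      (Submodule.smul_mem _ a (coe_mem_extendedHom hβ))
      (Submodule.smul_mem _ c (coe_mem_extendedHom hδ))
    rwa [Algebra.smul_def, Algebra.smul_def] at this

end

end SchmidtArrangement

/-! ### Kernel classes and unimodular rows -/

namespace SchmidtArrangement

noncomputable section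

open FractionalIdeal Module

variable {K : Type*} [Field K] [NumberField K]

/-- The multiplier ring recovers `f`, and the underlying set recovers the fractional ideal. -/
theorem RepresentsClass.sigma_unique {σ : K →+* ℂ} (F : QuadraticFrame σ) {Λ : Submodule ℤ (𝓞 K)}
    {a b : Σ f : ℕ+, (theta K f).ker} (ha : RepresentsClass Λ a.1 a.2.1)
    (hb : RepresentsClass Λ b.1 b.2.1) : a = b := by
  obtain ⟨f, c, hc⟩ := a
  obtain ⟨g, d, hd⟩ := b
  change RepresentsClass Λ f c at ha
  change RepresentsClass Λ g d at hb
  obtain ⟨hf, I, hI, rfl⟩ := ha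
  obtain ⟨hg, J, hJ, rfl⟩ := hb
  obtain rfl : f = g := F.conductorOrder_injective (hf.symm.trans hg)
  have : I = J := Units.ext (FractionalIdeal.ext fun x => (hI x).trans (hJ x).symm)
  subst this
  rfl

/-- The unit need not lie in `O_f`, but scaling by any nonzero element of `K` keeps the ideal class
and the multipliers. -/
theorem RepresentsClass.of_homothety {Λ Λ' : Submodule ℤ (𝓞 K)} {f : ℕ+}
    {c : ClassGroup (conductorOrder K f)} (h : RepresentsClass Λ f c) (μ : (𝓞 K)ˣ)
    (hμ : ∀ x, x ∈ Λ' ↔ ∃ y ∈ Λ, (μ : 𝓞 K) * y = x) : RepresentsClass Λ' f c := by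
  obtain ⟨hord, I, hI, rfl⟩ := h
  have hμ0 : ((μ : 𝓞 K) : K) ≠ 0 := by simp
  refine ⟨?_, toPrincipalIdeal (conductorOrder K f) K (Units.mk0 _ hμ0) * I, ?_, ?_⟩
  · rw [← hord]
    ext α
    change (∀ x ∈ Λ', α * x ∈ Λ') ↔ ∀ x ∈ Λ, α * x ∈ Λ
    constructor
    · intro h x hx
      obtain ⟨y, hy, hyx⟩ := (hμ _).1 (h _ ((hμ _).2 ⟨x, hx, rfl⟩))
      have : y = α * x := mul_left_cancel₀ μ.ne_zero (by rw [hyx]; ring)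
      exact this ▸ hy
    · intro h x hx
      obtain ⟨y, hy, rfl⟩ := (hμ _).1 hx
      exact (hμ _).2 ⟨α * y, h y hy, by ring⟩
  · intro x
    rw [Units.val_mul, coe_toPrincipalIdeal, Units.val_mk0, mem_singleton_mul]
    constructor
    · rintro ⟨y, hy, rfl⟩
      obtain ⟨z, hz, rfl⟩ := (hI y).1 hy
      exact ⟨μ * z, (hμ _).2 ⟨z, hz, rfl⟩, by simp⟩
    · rintro ⟨y, hy, rfl⟩
      obtain ⟨z, hz, rfl⟩ := (hμ y).1 hy
      exact ⟨z, (hI z).2 ⟨z, hz, rfl⟩, by simp⟩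
  · rw [eq_comm, ClassGroup.mk_eq_mk_iff_exists_spanSingleton]
    exact ⟨_, hμ0, by rw [Units.val_mul, coe_toPrincipalIdeal, Units.val_mk0]⟩

/-- The two ideals differ by a factor `x` of `K`. Unimodularity of `(β, δ)` makes `x` integral, and
that of `(β', δ')` makes `x⁻¹` integral. -/
theorem exists_unit_of_representsClass {a b β δ a' b' β' δ' : 𝓞 K} (h : a * β + b * δ = 1)
    (h' : a' * β' + b' * δ' = 1) {f : ℕ+} {c : ClassGroup (conductorOrder K f)}
    (hc : RepresentsClass (lattice β δ) f c) (hc' : RepresentsClass (lattice β' δ') f c) :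
    ∃ l : (𝓞 K)ˣ, ∀ x ∈ lattice β' δ', ∃ y ∈ lattice β δ, (l : 𝓞 K) * y = x := by
  obtain ⟨-, I, hI, rfl⟩ := hc
  obtain ⟨-, I', hI', heq⟩ := hc'
  obtain ⟨x, hx0, hx⟩ := ClassGroup.mk_eq_mk_iff_exists_spanSingleton.1 heq.symm
  have fwd : ∀ y ∈ lattice β δ, ∃ z ∈ lattice β' δ', (z : K) = x * y := by
    intro y hy
    refine (hI' _).1 ?_
    rw [← hx, mem_singleton_mul]
    exact ⟨y, (hI _).2 ⟨y, hy, rfl⟩, rfl⟩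
  have bwd : ∀ z ∈ lattice β' δ', ∃ y ∈ lattice β δ, (z : K) = x * y := by
    intro z hz
    have hz' := (hI' z).2 ⟨z, hz, rfl⟩
    rw [← hx, mem_singleton_mul] at hz'
    obtain ⟨y, hy, hyz⟩ := hz'
    obtain ⟨y, hy', rfl⟩ := (hI y).1 hy
    exact ⟨y, hy', hyz⟩
  obtain ⟨z₁, -, e₁⟩ := fwd β (left_mem_lattice β δ)
  obtain ⟨z₂, -, e₂⟩ := fwd δ (right_mem_lattice β δ)
  obtain ⟨y₁, -, e₃⟩ := bwd β' (left_mem_lattice β' δ')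
  obtain ⟨y₂, -, e₄⟩ := bwd δ' (right_mem_lattice β' δ')
  have hK := congrArg (algebraMap (𝓞 K) K) h
  have hK' := congrArg (algebraMap (𝓞 K) K) h'
  simp only [map_add, map_mul, map_one] at hK hK'
  have hl : ((a * z₁ + b * z₂ : 𝓞 K) : K) = x := by
    simp only [map_add, map_mul, e₁, e₂]
    linear_combination x * hK
  have hl' : x * ((a' * y₁ + b' * y₂ : 𝓞 K) : K) = 1 := by
    simp only [map_add, map_mul]
    linear_combination hK' - (a' : K) * e₃ - (b' : K) * e₄
  have hu : IsUnit (a * z₁ + b * z₂) := by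
    refine IsUnit.of_mul_eq_one (a' * y₁ + b' * y₂) (RingOfIntegers.ext ?_)
    rw [coe_ringOfIntegers_mul, hl, hl', coe_ringOfIntegers_one]
  refine ⟨hu.unit, fun z hz => ?_⟩
  obtain ⟨y, hy, hzy⟩ := bwd z hz
  refine ⟨y, hy, RingOfIntegers.ext ?_⟩
  rw [coe_ringOfIntegers_mul, IsUnit.unit_spec, hl, hzy]

namespace QuadraticFrame

variable {σ : K →+* ℂ} (F : QuadraticFrame σ)

theorem abs_cross_of_latticeOrder {a c β δ : 𝓞 K} (h : a * β + c * δ = 1) {f : ℕ+}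
    (hf : latticeOrder (lattice β δ) = conductorOrder K f) : |F.cross β δ| = (f : ℕ) := by
  have h0 := F.cross_ne_zero_of_latticeOrder h hf
  let g : ℕ+ := ⟨(F.cross β δ).natAbs, Int.natAbs_pos.2 h0⟩
  have hg : |F.cross β δ| = (g : ℕ) := Int.abs_eq_natAbs _
  rw [F.conductorOrder_injective ((F.latticeOrder_lattice h hg).symm.trans hf)] at hg
  exact hg

/-- A lattice generating the unit ideal represents a class in the kernel of the extension map. -/
theorem exists_representsClass {a c β δ : 𝓞 K} (h : a * β + c * δ = 1) (h0 : F.cross β δ ≠ 0) :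
    ∃ p : Σ f : ℕ+, (theta K f).ker, RepresentsClass (lattice β δ) p.1 p.2.1 := by
  let f : ℕ+ := ⟨(F.cross β δ).natAbs, Int.natAbs_pos.2 h0⟩
  have hf : |F.cross β δ| = (f : ℕ) := Int.abs_eq_natAbs _
  have hf' : |F.cross (F.conj β) (F.conj δ)| = (f : ℕ) := by rw [F.cross_conj, abs_neg, hf]
  have h1 : ∀ x ∈ conductorOrder K f, ∀ y ∈ lattice β δ, x * y ∈ lattice β δ :=
    fun x hx y hy => F.mul_mem_lattice hf hx hy
  have h2 : ∀ x ∈ conductorOrder K f, ∀ y ∈ lattice (F.conj β) (F.conj δ),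
      x * y ∈ lattice (F.conj β) (F.conj δ) :=
    fun x hx y hy => F.mul_mem_lattice hf' hx hy
  have hmul := F.latticeIdeal_mul_conj h hf h1 h2
  let I : (FractionalIdeal (conductorOrder K f)⁰ K)ˣ :=
    ⟨_, _, hmul, (mul_comm _ _).trans hmul⟩
  have hI : ∀ x : K, x ∈ (I : FractionalIdeal (conductorOrder K f)⁰ K) ↔
      ∃ y ∈ lattice β δ, (y : K) = x := fun x => mem_latticeIdeal (h := h1)
  refine ⟨⟨f, ClassGroup.mk K I, ?_⟩, F.latticeOrder_lattice h hf, I, hI, rfl⟩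
  rw [MonoidHom.mem_ker, theta_mk]
  have : Units.map (FractionalIdeal.extendedHom K (𝓞 K)).toMonoidHom I = 1 := by
    apply Units.ext
    exact extendedHom_eq_one (fun x hx => by
      obtain ⟨y, -, rfl⟩ := (hI x).1 hx
      exact ⟨y, rfl⟩) h ((hI _).2 ⟨β, left_mem_lattice _ _, rfl⟩)
      ((hI _).2 ⟨δ, right_mem_lattice _ _, rfl⟩)
  rw [this, map_one]

end QuadraticFrame

/-- A subgroup of a ring of integers of rank two has two generators. -/
theorem exists_eq_lattice [Algebra.IsQuadraticExtension ℚ K] (Λ : Submodule ℤ (𝓞 K)) :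
    ∃ β δ : 𝓞 K, Λ = lattice β δ := by
  obtain ⟨n, ⟨e⟩⟩ := Submodule.nonempty_basis_of_pid (RingOfIntegers.basis K) Λ
  have hn : n ≤ 2 := by
    have h1 := Submodule.finrank_le Λ
    rwa [finrank_eq_card_basis e, Fintype.card_fin, RingOfIntegers.rank,
      Algebra.IsQuadraticExtension.finrank_eq_two] at h1
  have hsum : ∀ x ∈ Λ, ∃ g : Fin n → ℤ, x = ∑ i, g i • (e i : 𝓞 K) := by
    intro x hx
    refine ⟨fun i => e.repr ⟨x, hx⟩ i, ?_⟩
    have := congrArg Λ.subtype (e.sum_repr ⟨x, hx⟩)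
    rw [map_sum] at this
    exact this.symm
  -- Rank below two is padded with zero generators, so full rank need not be proved.
  interval_cases n
  · refine ⟨0, 0, le_antisymm (fun x hx => ?_) (Submodule.span_le.2 ?_)⟩
    · obtain ⟨g, rfl⟩ := hsum x hx
      simp
    · rintro x hx
      simp at hx
      simp [hx]
  · refine ⟨e 0, 0, le_antisymm (fun x hx => ?_) (Submodule.span_le.2 ?_)⟩
    · obtain ⟨g, rfl⟩ := hsum x hx
      exact mem_lattice.2 ⟨g 0, 0, by simp⟩
    · rintro x (rfl | rfl)
      · exact (e 0).2
      · exact Λ.zero_mem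
  · refine ⟨e 0, e 1, le_antisymm (fun x hx => ?_) (Submodule.span_le.2 ?_)⟩
    · obtain ⟨g, rfl⟩ := hsum x hx
      exact mem_lattice.2 ⟨g 0, g 1, by simp [Fin.sum_univ_two]⟩
    · rintro x (rfl | rfl)
      · exact (e 0).2
      · exact (e 1).2

/-- Every class in the kernel of the extension map is represented by the lattice of the bottom row
of a matrix of determinant one. -/
theorem exists_matrix_of_mem_ker [Algebra.IsQuadraticExtension ℚ K] {f : ℕ+}
    {c : ClassGroup (conductorOrder K f)} (hc : c ∈ (theta K f).ker) :
    ∃ M : Matrix.SpecialLinearGroup (Fin 2) (𝓞 K),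
      RepresentsClass (lattice (M 1 0) (M 1 1)) f c := by
  obtain ⟨I₀, rfl⟩ : ∃ I₀ : (FractionalIdeal (conductorOrder K f)⁰ K)ˣ, ClassGroup.mk K I₀ = c :=
    ClassGroup.induction K (fun I => ⟨I, rfl⟩) c
  rw [MonoidHom.mem_ker, theta_mk, ← map_one (ClassGroup.mk K),
    ClassGroup.mk_eq_mk_iff_exists_spanSingleton] at hc
  obtain ⟨g, hg0, hg⟩ := hc
  -- The scaling makes the extension equal to `𝓞 K`, not merely principal, which places `I` inside
  -- `𝓞 K`.
  let I : (FractionalIdeal (conductorOrder K f)⁰ K)ˣ :=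
    toPrincipalIdeal (conductorOrder K f) K (Units.mk0 g hg0) * I₀
  have hIval : (I : FractionalIdeal (conductorOrder K f)⁰ K) =
      spanSingleton (conductorOrder K f)⁰ g * I₀ := by
    rw [Units.val_mul, coe_toPrincipalIdeal, Units.val_mk0]
  have hmk : ClassGroup.mk K I = ClassGroup.mk K I₀ := by
    rw [eq_comm, ClassGroup.mk_eq_mk_iff_exists_spanSingleton]
    exact ⟨g, hg0, hIval.symm⟩
  have hext : FractionalIdeal.extendedHom K (𝓞 K)
      (I : FractionalIdeal (conductorOrder K f)⁰ K) = 1 := by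
    rw [hIval, map_mul, extendedHom_spanSingleton]
    have hmap : IsFractionRing.map
        (FaithfulSMul.algebraMap_injective (conductorOrder K f) (𝓞 K)) g = g := by
      obtain ⟨x, y, -, rfl⟩ := IsFractionRing.div_surjective (A := conductorOrder K f) g
      rw [map_div₀]
      congr 1 <;> exact IsLocalization.map_eq _ _
    rw [hmap]
    exact hg
  have hint : ∀ x ∈ (I : FractionalIdeal (conductorOrder K f)⁰ K), ∃ y : 𝓞 K, (y : K) = x := by
    intro x hx
    have := coe_mem_extendedHom hx
    rw [hext, mem_one_iff] at this
    exact this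
  let Λ : Submodule ℤ (𝓞 K) :=
    { carrier := {y | (y : K) ∈ (I : FractionalIdeal (conductorOrder K f)⁰ K)}
      zero_mem' := by
        change ((0 : 𝓞 K) : K) ∈ (I : FractionalIdeal (conductorOrder K f)⁰ K)
        rw [show ((0 : 𝓞 K) : K) = 0 from map_zero (algebraMap (𝓞 K) K)]
        exact zero_mem _
      add_mem' := by
        intro x y hx hy
        change ((x + y : 𝓞 K) : K) ∈ (I : FractionalIdeal (conductorOrder K f)⁰ K)
        rw [coe_ringOfIntegers_add]
        exact Submodule.add_mem I.val.val hx hy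
      smul_mem' := by
        intro n x hx
        change ((n • x : 𝓞 K) : K) ∈ (I : FractionalIdeal (conductorOrder K f)⁰ K)
        rw [show ((n • x : 𝓞 K) : K) = n • (x : K) from map_zsmul (algebraMap (𝓞 K) K) n x]
        exact AddSubgroup.zsmul_mem I.val.val.toAddSubgroup hx n }
  have hΛ : ∀ x : K, x ∈ (I : FractionalIdeal (conductorOrder K f)⁰ K) ↔ ∃ y ∈ Λ, (y : K) = x := by
    intro x
    constructor
    · intro hx
      obtain ⟨y, rfl⟩ := hint x hx
      exact ⟨y, hx, rfl⟩
    · rintro ⟨y, hy, rfl⟩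
      exact hy
  have hord : latticeOrder Λ = conductorOrder K f := by
    apply le_antisymm
    · intro x hx
      -- Cancelling the invertible `I` from `x I ⊆ I` leaves `x ∈ O_f`.
      have h1 : spanSingleton (conductorOrder K f)⁰ (x : K) * I ≤
          (I : FractionalIdeal (conductorOrder K f)⁰ K) := by
        rw [spanSingleton_mul_le_iff]
        intro z hz
        obtain ⟨y, hy, rfl⟩ := (hΛ z).1 hz
        exact (hΛ _).2 ⟨x * y, hx y hy, by simp⟩
      have h2 := mul_le_mul_left h1 ((I⁻¹ : (FractionalIdeal (conductorOrder K f)⁰ K)ˣ) :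
        FractionalIdeal (conductorOrder K f)⁰ K)
      rw [mul_assoc, Units.mul_inv, mul_one, spanSingleton_le_iff_mem, mem_one_iff] at h2
      obtain ⟨y, hy⟩ := h2
      have : (y : 𝓞 K) = x := RingOfIntegers.ext hy
      exact this ▸ y.2
    · intro x hx y hy
      have := Submodule.smul_mem I.val.val (⟨x, hx⟩ : conductorOrder K f) hy
      change ((x * y : 𝓞 K) : K) ∈ (I : FractionalIdeal (conductorOrder K f)⁰ K)
      rw [coe_ringOfIntegers_mul]
      exact this
  obtain ⟨β, δ, hβδ⟩ := exists_eq_lattice Λ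
  obtain ⟨a, d, had⟩ : ∃ a d : 𝓞 K, a * β + d * δ = 1 := by
    have key : ∀ x ∈ Submodule.span (𝓞 K) (algebraMap K K ''
        (I : FractionalIdeal (conductorOrder K f)⁰ K)),
        ∃ a d : 𝓞 K, ((a * β + d * δ : 𝓞 K) : K) = x := by
      intro x hx
      induction hx using Submodule.span_induction with
      | mem x h =>
        obtain ⟨z, hz, rfl⟩ := h
        obtain ⟨y, hy, rfl⟩ := (hΛ z).1 hz
        rw [hβδ] at hy
        obtain ⟨p, q, rfl⟩ := mem_lattice.1 hy
        exact ⟨p, q, rfl⟩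
      | zero => exact ⟨0, 0, by simp⟩
      | add x y _ _ hx hy =>
        obtain ⟨a, d, rfl⟩ := hx
        obtain ⟨a', d', rfl⟩ := hy
        exact ⟨a + a', d + d', by rw [← coe_ringOfIntegers_add]; congr 1; ring⟩
      | smul r x _ hx =>
        obtain ⟨a, d, rfl⟩ := hx
        exact ⟨r * a, r * d, by
          rw [Algebra.smul_def, ← coe_ringOfIntegers_mul]; congr 1; ring⟩
    have h1 : (1 : K) ∈ FractionalIdeal.extendedHom K (𝓞 K)
        (I : FractionalIdeal (conductorOrder K f)⁰ K) := by
      rw [hext]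
      exact one_mem_one _
    rw [← FractionalIdeal.mem_coe, coe_extendedHom_eq_span] at h1
    obtain ⟨a, d, h⟩ := key 1 h1
    exact ⟨a, d, RingOfIntegers.ext (by rw [h, coe_ringOfIntegers_one])⟩
  refine ⟨⟨!![d, -a; β, δ], by rw [Matrix.det_fin_two_of]; linear_combination had⟩, ?_⟩
  change RepresentsClass (lattice β δ) f _
  rw [← hβδ]
  exact ⟨hord, I, hΛ, hmk⟩

end

end SchmidtArrangement

/-! ### The bijection -/

open SchmidtArrangement
/-- `K` is an imaginary quadratic field, embedded in `ℂ` by `σ`. The union of the kernels over all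
conductors `f ≥ 1` is a disjoint union, since classes of different orders are different. -/
theorem mainTheorem1 (K : Type*) [Field K] [NumberField K] [Algebra.IsQuadraticExtension ℚ K]
    [NumberField.IsTotallyComplex K] (σ : K →+* ℂ) :
    ∃ Φ : Quotient (bianchiSetoid σ) ≃ (Σ f : ℕ+, (theta K f).ker),
      (∀ C : BianchiCircle σ,
        HasCurvature C.1 (Real.sqrt (-(NumberField.discr K : ℝ)) * ((Φ ⟦C⟧).1 : ℕ))) ∧
      (∀ (M : Matrix.SpecialLinearGroup (Fin 2) (NumberField.RingOfIntegers K))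
        (C : BianchiCircle σ), C.1 = circleOf σ M →
          RepresentsClass (lattice (M 1 0) (M 1 1)) (Φ ⟦C⟧).1 (Φ ⟦C⟧).2.1) := by
  obtain ⟨F, hF⟩ := exists_quadraticFrame σ
  have hex : ∀ C : BianchiCircle σ, ∃ (M : Matrix.SpecialLinearGroup (Fin 2) (𝓞 K))
      (p : Σ f : ℕ+, (theta K f).ker), circleOf σ M = C.1 ∧
        RepresentsClass (lattice (M 1 0) (M 1 1)) p.1 p.2.1 := by
    rintro ⟨_, ⟨M, rfl⟩, hM⟩
    rw [infty_mem_circleOf σ M F] at hM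
    obtain ⟨p, hp⟩ := F.exists_representsClass (bezout_row M) hM
    exact ⟨M, p, rfl, hp⟩
  choose mat cls hmat hcls using hex
  -- Covers at once independence of the chosen matrix (`C = D`) and invariance under equivalence.
  have hwd : ∀ (C D : BianchiCircle σ) (M : Matrix.SpecialLinearGroup (Fin 2) (𝓞 K)),
      C ≈ D → D.1 = circleOf σ M →
        RepresentsClass (lattice (M 1 0) (M 1 1)) (cls C).1 (cls C).2.1 := by
    intro C D M hCD hD
    have h : CircleEquiv σ C.1 D.1 := hCD
    rw [← hmat C, hD] at h
    obtain ⟨μ, hμ⟩ := F.exists_unit_of_circleEquiv h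
    exact (hcls C).of_homothety μ hμ
  let φ : Quotient (bianchiSetoid σ) → Σ f : ℕ+, (theta K f).ker :=
    Quotient.lift cls fun C D h =>
      RepresentsClass.sigma_unique F (hwd C D (mat D) h (hmat D).symm) (hcls D)
  have hinj : Function.Injective φ := by
    rintro ⟨C⟩ ⟨D⟩ h
    change cls C = cls D at h
    apply Quotient.sound
    change CircleEquiv σ C.1 D.1
    have hD := hcls D
    rw [← h] at hD
    have hC := hcls C
    obtain ⟨l, hl⟩ := exists_unit_of_representsClass (bezout_row _) (bezout_row _) hC hD
    rw [← hmat C, ← hmat D]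
    exact F.circleEquiv_of_lattice l hl
      (F.cross_ne_zero_of_latticeOrder (bezout_row _) hC.1)
      ((F.abs_cross_of_latticeOrder (bezout_row _) hC.1).trans
        (F.abs_cross_of_latticeOrder (bezout_row _) hD.1).symm)
  have hsurj : Function.Surjective φ := by
    intro p
    obtain ⟨M, hM⟩ := exists_matrix_of_mem_ker p.2.2
    have hinf : ∞ ∉ circleOf σ M := by
      rw [infty_mem_circleOf σ M F]
      exact F.cross_ne_zero_of_latticeOrder (bezout_row M) hM.1
    let C : BianchiCircle σ := ⟨circleOf σ M, ⟨M, rfl⟩, hinf⟩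
    refine ⟨⟦C⟧, ?_⟩
    exact RepresentsClass.sigma_unique F (hwd C C M (Setoid.refl C) rfl) hM
  refine ⟨Equiv.ofBijective φ ⟨hinj, hsurj⟩, fun C => ?_, fun M C hC => ?_⟩
  · change HasCurvature C.1 (√(-(discr K : ℝ)) * ((cls C).1 : ℕ))
    have h := hasCurvature_circleOf σ (mat C) F
    rw [hmat C, hF, ← Int.cast_abs,
      F.abs_cross_of_latticeOrder (bezout_row (mat C)) (hcls C).1, Int.cast_natCast] at h
    exact h
  · exact hwd C C M (Setoid.refl C) hC
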